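/- **Setting.** Let $m=d_1+\dots+d_k$ with all $d_j\ge 1$, let $W_1,\dots,W_k$ be 2-dimensional real vector spaces, and for each $j$ let $\Gamma_j\in\bigotimes_{r\ne j}(W_r^*)^{\otimes d_r}$ be a non-zero tensor, such that the space $$\mathfrak h=\sum_{j=1}^k \mathrm{ins}_j\bigl(S^{d_j}W_j^*\otimes\Gamma_j\bigr)\subset V^*=\bigotimes_{i=1}^k (W_i^*)^{\otimes d_i}$$ has dimension $m+1$; here $\mathrm{ins}_j$ puts the first factor into the $d_j$ slots of group $j$ and the second into the remaining slots. The inclusion $\mathfrak h\hookrightarrow V^*$ is a (standard) Segre–Veronese factorization structure. Fix a basis of each $W_i$ and write, for $x=(x_{ir})$, $1\le i\le k$, $1\le r\le d_i$, $$\langle\mu,h\rangle=\Bigl\langle\bigotimes_{i,r}(1,x_{ir}),h\Bigr\rangle\ (h\in\mathfrak h),\qquad \hat{\mathbf x}_i=\bigotimes_{j\ne i}\bigotimes_{s}(1,x_{js}),\qquad \Delta_{ir}=\prod_{s\ne r}(x_{ir}-x_{is}),$$ $$\psi_{ir}(x_{ir})=\mathrm{ins}_i\bigl((x_{ir},-1)^{\otimes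 d_i}\otimes\Gamma_i\bigr)\in\mathfrak h .$$ Let $\beta\in\mathfrak h$, $\mu_\beta=\mu/\langle\mu,\beta\rangle$, and let $t$ be the $\mathfrak t=\mathfrak h/\langle\beta\rangle$-valued angular coordinate. On a connected open set $\Omega$ of points $(x,t)\in\mathbb R^m\times\mathfrak t$, let $A_{ir}$ be smooth non-vanishing functions of the single variable $x_{ir}$ (on the range of $x_{ir}$ over $\Omega$), and assume that on $\Omega$ one has $\langle\mu,\beta\rangle\neq0$ and $\dfrac{\Delta_{ir}\langle\hat{\mathbf x}_i,\Gamma_i\rangle}{A_{ir}(x_{ir})\langle\mu,\beta\rangle}>0$ for all $(i,r)$. The associated separable Kähler geometry on $\Omega$ is $$g_\beta=\sum_{i,r}\Bigl(\frac{\Delta_{ir}\langle\hat{\mathbf x}_i,\Gamma_i\rangle}{A_{ir}(x_{ir})\langle\mu,\beta\rangle}\,dx_{ir}^2+\frac{A_{ir}(x_{ir})\langle\mu,\beta\rangle}{\Delta_{ir}\langle\hat{\mathbf x}_i,\Gamma_i\rangle}\langle\partial_{x_{ir}}\mu_\beta,dt\rangle^2\Bigr),\qquad \omega_\beta=\sum_{i,r}dx_{ir}\wedge\langle\partial_{x_{ir}}\mu_\beta,dt\rangle,$$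 $$J_\beta dx_{ir}=\frac{A_{ir}(x_{ir})\langle\mu,\beta\rangle}{\Delta_{ir}\langle\hat{\mathbf x}_i,\Gamma_i\rangle}\langle\partial_{x_{ir}}\mu_\beta,dt\rangle,\qquad J_\beta dt=\sum_{i,r}\frac{\psi_{ir}(x_{ir})\bmod\beta}{A_{ir}(x_{ir})}\,dx_{ir}$$ (where $(J_\beta\alpha)(X)=-\alpha(J_\beta X)$ for 1-forms $\alpha$ and vectors $X$). It is called *extremal* if its scalar curvature is a Killing potential, i.e. if $J_\beta\,\mathrm{grad}_{g_\beta}\mathrm{Scal}(g_\beta)$ is a Killing vector field of $g_\beta$ on $\Omega$. **Theorem.** On $\Omega$, the scalar curvature of the separable Kähler geometry above is $$\mathrm{Scal}(g_\beta)=-\sum_{i=1}^k\sum_{r=1}^{d_i}\frac{\langle\mu,\beta\rangle^{m+2}}{\Delta_{ir}\langle\hat{\mathbf x}_i,\Gamma_i\rangle\prod_{p=1}^k\langle\hat{\mathbf x}_p,\Gamma_p\rangle^{d_p}}\;\partial_{x_{ir}}^2\Bigl(\frac{A_{ir}(x_{ir})}{\langle\mu,\beta\rangle^{m+1}}\prod_{j=1}^k\langle\hat{\mathbf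 x}_j,\Gamma_j\rangle^{d_j}\Bigr),$$ and the geometry is extremal if and only if there exists $\alpha\in\mathfrak h$ such that on $\Omega$ $$\sum_{i=1}^k\sum_{r=1}^{d_i}\frac{\langle\mu,\beta\rangle^{m+3}}{\Delta_{ir}\langle\hat{\mathbf x}_i,\Gamma_i\rangle\prod_{p=1}^k\langle\hat{\mathbf x}_p,\Gamma_p\rangle^{d_p}}\;\partial_{x_{ir}}^2\Bigl(\frac{A_{ir}(x_{ir})}{\langle\mu,\beta\rangle^{m+1}}\prod_{j=1}^k\langle\hat{\mathbf x}_j,\Gamma_j\rangle^{d_j}\Bigr)=\langle\mu,\alpha\rangle .$$ -/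

import Mathlib

open scoped ContDiff

noncomputable section

/-! ### Riemannian geometry in a coordinate chart

The chart is an open subset of `n → ℝ`, a metric is given by its matrix of components. -/

section Chart

variable {n : Type*} [Fintype n] [DecidableEq n]

/-- The partial derivative `∂f/∂y_a` at the point `y`. -/
def partialDeriv (a : n) (f : (n → ℝ) → ℝ) (y : n → ℝ) : ℝ :=
  fderiv ℝ f y (Pi.single a 1)

/-- The Christoffel symbol `Γ^c_{ab} = ½ g^{cl} (∂_a g_{bl} + ∂_b g_{al} - ∂_l g_{ab})`. -/
def christoffel (g : (n → ℝ) → Matrix n n ℝ) (c a b : n) (y : n → ℝ) : ℝ :=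
  (1 / 2) * ∑ l, (g y)⁻¹ c l *
    (partialDeriv a (fun z => g z b l) y + partialDeriv b (fun z => g z a l) y
      - partialDeriv l (fun z => g z a b) y)

/-- The component `R^l_{cab}` of the Riemann curvature tensor,
`R(∂_a, ∂_b) ∂_c = R^l_{cab} ∂_l` with `R(X, Y) = [∇_X, ∇_Y] - ∇_{[X, Y]}`. -/
def riemannCurvature (g : (n → ℝ) → Matrix n n ℝ) (l c a b : n) (y : n → ℝ) : ℝ :=
  partialDeriv a (christoffel g l b c) y - partialDeriv b (christoffel g l a c) y
    + ∑ p, (christoffel g l a p y * christoffel g p b c y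
      - christoffel g l b p y * christoffel g p a c y)

/-- The Ricci tensor `Ric_{cb} = R^a_{cab}`. -/
def ricciCurvature (g : (n → ℝ) → Matrix n n ℝ) (c b : n) (y : n → ℝ) : ℝ :=
  ∑ a, riemannCurvature g a c a b y

/-- The scalar curvature `g^{cb} Ric_{cb}`. -/
def scalarCurvature (g : (n → ℝ) → Matrix n n ℝ) (y : n → ℝ) : ℝ :=
  ∑ c, ∑ b, (g y)⁻¹ c b * ricciCurvature g c b y

/-- The gradient of `f` with respect to `g`. -/
def metricGradient (g : (n → ℝ) → Matrix n n ℝ) (f : (n → ℝ) → ℝ) (y : n → ℝ) : n → ℝ :=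
  fun a => ∑ b, (g y)⁻¹ a b * partialDeriv b f y

/-- The component `(L_X g)_{ab}` of the Lie derivative of `g` along the vector field `X`. -/
def lieDerivMetric (g : (n → ℝ) → Matrix n n ℝ) (X : (n → ℝ) → n → ℝ) (a b : n)
    (y : n → ℝ) : ℝ :=
  ∑ c, (X y c * partialDeriv c (fun z => g z a b) y
    + g y c b * partialDeriv a (fun z => X z c) y
    + g y a c * partialDeriv b (fun z => X z c) y)

/-- `X` is a Killing vector field of `g` on `Ω`. -/
def IsKillingOn (g : (n → ℝ) → Matrix n n ℝ) (X : (n → ℝ) → n → ℝ) (Ω : Set (n → ℝ)) : Prop :=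
  ∀ y ∈ Ω, ∀ a b, lieDerivMetric g X a b y = 0

/-- `f` is a Killing potential on `Ω` of the Kähler structure with metric `g` and complex
structure `J` (acting on tangent vectors): the vector field `J grad_g f` is Killing. -/
def IsKillingPotentialOn (g J : (n → ℝ) → Matrix n n ℝ) (f : (n → ℝ) → ℝ)
    (Ω : Set (n → ℝ)) : Prop :=
  IsKillingOn g (fun y => (J y).mulVec (metricGradient g f y)) Ω

/-- The Kähler structure `(g, J)` is extremal on `Ω`: the scalar curvature is a Killing
potential. -/
def IsExtremalOn (g J : (n → ℝ) → Matrix n n ℝ) (Ω : Set (n → ℝ)) : Prop :=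
  IsKillingPotentialOn g J (scalarCurvature g) Ω

end Chart

/-! ### Segre–Veronese factorization structures -/

/-- The slots `(i, r)`, `1 ≤ r ≤ d_i`. -/
abbrev Slot {k : ℕ} (d : Fin k → ℕ) : Type := Σ i : Fin k, Fin (d i)

section Updates

variable {k : ℕ} {d : Fin k → ℕ} {W : Fin k → Type*}

theorem update_group (w : ∀ I : Slot d, W I.1) (i : Fin k) (r : Fin (d i)) (u : W i) :
    (fun q => Function.update w ⟨i, r⟩ u ⟨i, q⟩)
      = Function.update (fun q => w ⟨i, q⟩) r u := by
  funext q
  by_cases h : q = r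
  · subst h; simp
  · simp [Function.update, h]

theorem update_off_self (w : ∀ I : Slot d, W I.1) (i : Fin k) (r : Fin (d i)) (u : W i) :
    (fun I : {I : Slot d // I.1 ≠ i} => Function.update w ⟨i, r⟩ u I.1)
      = fun I : {I : Slot d // I.1 ≠ i} => w I.1 := by
  funext I
  exact Function.update_of_ne (fun h => I.2 (by rw [h])) _ _

theorem update_group_ne (w : ∀ I : Slot d, W I.1) {i j : Fin k} (hi : i ≠ j) (r : Fin (d i))
    (u : W i) :
    (fun q : Fin (d j) => Function.update w ⟨i, r⟩ u ⟨j, q⟩) = fun q => w ⟨j, q⟩ := by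
  funext q
  exact Function.update_of_ne (fun h => hi (congrArg Sigma.fst h).symm) _ _

theorem update_off (w : ∀ I : Slot d, W I.1) {i j : Fin k} (hi : i ≠ j) (r : Fin (d i))
    (u : W i) :
    (fun I : {I : Slot d // I.1 ≠ j} => Function.update w ⟨i, r⟩ u I.1)
      = Function.update (fun I : {I : Slot d // I.1 ≠ j} => w I.1) ⟨⟨i, r⟩, hi⟩ u := by
  funext I
  by_cases h : I = ⟨⟨i, r⟩, hi⟩
  · subst h; simp
  · rw [Function.update_of_ne h, Function.update_of_ne (fun h' => h (Subtype.ext h'))]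

end Updates

section FactorizationStructure

variable {k : ℕ} (d : Fin k → ℕ) (W : Fin k → Type*) [∀ i, AddCommGroup (W i)]
  [∀ i, Module ℝ (W i)]

/-- The space `V^* = ⨂_i (W_i^*)^{⊗ d_i}`, as the space of multilinear forms on the slots. -/
abbrev TensorSpace : Type _ := MultilinearMap ℝ (fun I : Slot d => W I.1) ℝ

/-- The space `⨂_{i ≠ j} (W_i^*)^{⊗ d_i}`. -/
abbrev TensorSpaceOff (j : Fin k) : Type _ :=
  MultilinearMap ℝ (fun I : {I : Slot d // I.1 ≠ j} => W I.1.1) ℝ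

/-- The symmetric tensors `S^n U^* ⊆ (U^*)^{⊗ n}`, as symmetric multilinear forms. -/
def symmetricTensors (n : ℕ) (U : Type*) [AddCommGroup U] [Module ℝ U] :
    Submodule ℝ (MultilinearMap ℝ (fun _ : Fin n => U) ℝ) where
  carrier := {s | ∀ (σ : Equiv.Perm (Fin n)) (w : Fin n → U), s (fun r => w (σ r)) = s w}
  add_mem' hs ht σ w := by rw [add_apply, add_apply, hs σ w, ht σ w]
  zero_mem' σ w := by simp
  smul_mem' c s hs σ w := by rw [smul_apply, smul_apply, hs σ w]

variable {d W}

/-- `ins_j (s ⊗ γ)`: the tensor with `s` in the slots of group `j` and `γ` in the others,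
as a linear function of `s`. -/
def insTensor (j : Fin k) (γ : TensorSpaceOff d W j) :
    MultilinearMap ℝ (fun _ : Fin (d j) => W j) ℝ →ₗ[ℝ] TensorSpace d W where
  toFun s := MultilinearMap.mk' (fun w => s (fun r => w ⟨j, r⟩) * γ (fun I => w I.1))
    (fun w I u v => by
      obtain ⟨i, r⟩ := I
      by_cases hi : i = j
      · subst hi
        simp only [update_group, update_off_self, MultilinearMap.map_update_add, add_mul]
      · simp only [update_group_ne w hi, update_off w hi, MultilinearMap.map_update_add, mul_add])
    (fun w I c u => by
      obtain ⟨i, r⟩ := I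
      by_cases hi : i = j
      · subst hi
        simp only [update_group, update_off_self, MultilinearMap.map_update_smul, smul_eq_mul,
          mul_assoc]
      · simp only [update_group_ne w hi, update_off w hi, MultilinearMap.map_update_smul,
          smul_eq_mul, mul_left_comm])
  map_add' s t := by ext w; simp [add_mul]
  map_smul' c s := by ext w; simp [mul_assoc]

end FactorizationStructure

/-- A standard Segre–Veronese factorization structure with partition `m = d_1 + ⋯ + d_k` and
two-dimensional spaces `W_1, …, W_k`: the defining tensors `Γ_j` (a non-zero tensor spanning the
one-dimensional space) are such that `∑_j ins_j (S^{d_j} W_j^* ⊗ Γ_j)` has dimension `m + 1`. -/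
structure SegreVeronese {k : ℕ} (d : Fin k → ℕ) (W : Fin k → Type*) [∀ i, AddCommGroup (W i)]
    [∀ i, Module ℝ (W i)] where
  /-- The defining tensors. -/
  Γ : ∀ j, TensorSpaceOff d W j
  d_pos : ∀ j, 1 ≤ d j
  finrank_W : ∀ j, Module.finrank ℝ (W j) = 2
  Γ_ne_zero : ∀ j, Γ j ≠ 0
  finrank_image : Module.finrank ℝ
    (⨆ j, (symmetricTensors (d j) (W j)).map (insTensor j (Γ j)) : Submodule ℝ (TensorSpace d W))
      = (∑ j, d j) + 1

namespace SegreVeronese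

variable {k : ℕ} {d : Fin k → ℕ} {W : Fin k → Type*} [∀ i, AddCommGroup (W i)]
  [∀ i, Module ℝ (W i)] (S : SegreVeronese d W)

/-- The space `𝔥 = ∑_j ins_j (S^{d_j} W_j^* ⊗ Γ_j) ⊆ V^*`; the factorization structure is the
inclusion. -/
def space : Submodule ℝ (TensorSpace d W) :=
  ⨆ j, (symmetricTensors (d j) (W j)).map (insTensor j (S.Γ j))

variable (e : ∀ i, Module.Basis (Fin 2) ℝ (W i))

/-- The vectors `(1, x_{ir}) ∈ W_i`, in the affine charts given by bases `e_i` of the `W_i`. -/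
def point (_S : SegreVeronese d W) (x : Slot d → ℝ) (I : Slot d) : W I.1 :=
  e I.1 0 + x I • e I.1 1

/-- The function `⟨μ, h⟩ = ⟨⨂_{i,r} (1, x_{ir}), h⟩`, for `h ∈ 𝔥`. -/
def pairing (h : S.space) (x : Slot d → ℝ) : ℝ :=
  (h : TensorSpace d W) (S.point e x)

/-- The function `⟨x̂_i, Γ_i⟩`, where `x̂_i = ⨂_{j ≠ i} ⨂_s (1, x_{js})`. -/
def pairingOff (i : Fin k) (x : Slot d → ℝ) : ℝ :=
  S.Γ i (fun I => S.point e x I.1)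

/-- The product `∏_p ⟨x̂_p, Γ_p⟩^{d_p}`. -/
def pairingProd (x : Slot d → ℝ) : ℝ :=
  ∏ p, S.pairingOff e p x ^ d p

/-- The Vandermonde factor `Δ_{ir} = ∏_{s ≠ r} (x_{ir} - x_{is})`. -/
def vandermonde (_S : SegreVeronese d W) (I : Slot d) (x : Slot d → ℝ) : ℝ :=
  ∏ s ∈ Finset.univ.erase I.2, (x I - x ⟨I.1, s⟩)

/-- The component `⟨μ_β, h⟩ = ⟨μ, h⟩ / ⟨μ, β⟩` of the momentum map `μ_β`. -/
def momentum (β h : S.space) (x : Slot d → ℝ) : ℝ :=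
  S.pairing e h x / S.pairing e β x

/-- The linear form `(t, -1) ∈ W_i^*`. -/
def annForm (_S : SegreVeronese d W) (i : Fin k) (t : ℝ) : W i →ₗ[ℝ] ℝ :=
  t • (e i).coord 0 - (e i).coord 1

/-- The factorization curve in its affine chart,
`ψ_{ir}(t) = ins_i ((t, -1)^{⊗ d_i} ⊗ Γ_i) ∈ 𝔥`. -/
def curve (i : Fin k) (t : ℝ) : S.space :=
  ⟨insTensor i (S.Γ i)
      ((MultilinearMap.mkPiAlgebra ℝ (Fin (d i)) ℝ).compLinearMap (fun _ => S.annForm e i t)),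
    Submodule.mem_iSup_of_mem i (Submodule.mem_map_of_mem (fun σ w => by
      simpa using Equiv.prod_comp σ (fun r => S.annForm e i t (w r))))⟩

/-! The separable Kähler geometry with parameters `β ∈ 𝔥` and `A_{ir}`, in the coordinates
`y = (x_{ir}, t_a)`, indexed by `Slot d ⊕ Slot d`. A basis `b` of `𝔥` with `b none = β` is fixed,
and `t_a` are the components of the angular coordinate `t` in the basis `b_a mod β` of
`𝔱 = 𝔥 / ⟨β⟩`, so that `⟨∂_{x_{ir}} μ_β, dt⟩ = ∑_a ∂_{x_{ir}} ⟨μ_β, b_a⟩ dt_a`. -/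

variable (A : Slot d → ℝ → ℝ) (β : S.space) (b : Module.Basis (Option (Slot d)) ℝ S.space)

/-- The separable coordinates of a point of the chart. -/
abbrev xCoord (y : Slot d ⊕ Slot d → ℝ) : Slot d → ℝ := fun I => y (Sum.inl I)

/-- The coefficient `Δ_{ir} ⟨x̂_i, Γ_i⟩ / (A_{ir}(x_{ir}) ⟨μ, β⟩)` of `dx_{ir}²`. -/
def metricCoeff (I : Slot d) (x : Slot d → ℝ) : ℝ :=
  S.vandermonde I x * S.pairingOff e I.1 x / (A I (x I) * S.pairing e β x)

/-- The coefficient `∂_{x_{ir}} ⟨μ_β, b_a⟩` of `dt_a` in `⟨∂_{x_{ir}} μ_β, dt⟩`. -/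
def thetaCoeff (I a : Slot d) (x : Slot d → ℝ) : ℝ :=
  partialDeriv I (S.momentum e β (b (some a))) x

/-- The metric `g_β = ∑_{i,r} (Δ_{ir} ⟨x̂_i, Γ_i⟩ / (A_{ir} ⟨μ, β⟩) dx_{ir}²
+ A_{ir} ⟨μ, β⟩ / (Δ_{ir} ⟨x̂_i, Γ_i⟩) ⟨∂_{x_{ir}} μ_β, dt⟩²)`. -/
def metric (y : Slot d ⊕ Slot d → ℝ) : Matrix (Slot d ⊕ Slot d) (Slot d ⊕ Slot d) ℝ :=
  Matrix.fromBlocks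
    (Matrix.diagonal fun I => S.metricCoeff e A β I (xCoord y)) 0
    0 (Matrix.of fun a c => ∑ I, (S.metricCoeff e A β I (xCoord y))⁻¹ *
        (S.thetaCoeff e β b I a (xCoord y) * S.thetaCoeff e β b I c (xCoord y)))

/-- The complex structure `J_β` on tangent vectors, in block form with respect to
`(∂_{x_{ir}}, ∂_{t_a})`:
`J ∂_{x_{ir}} = - (ψ_{ir}(x_{ir}) mod β) / A_{ir}(x_{ir})` and
`J ∂_{t_a} = - ∑_{i,r} A_{ir} ⟨μ, β⟩ / (Δ_{ir} ⟨x̂_i, Γ_i⟩) (∂_{x_{ir}} ⟨μ_β, b_a⟩) ∂_{x_{ir}}`. -/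
def complexStructure (y : Slot d ⊕ Slot d → ℝ) :
    Matrix (Slot d ⊕ Slot d) (Slot d ⊕ Slot d) ℝ :=
  Matrix.fromBlocks
    0 (Matrix.of fun I a =>
        -((S.metricCoeff e A β I (xCoord y))⁻¹ * S.thetaCoeff e β b I a (xCoord y)))
    (Matrix.of fun a I => -(b.repr (S.curve e I.1 (xCoord y I)) (some a) / A I (xCoord y I))) 0

end SegreVeronese

end

noncomputable section

/-! ### Calculus of partial derivatives -/

set_option linter.unusedSectionVars false

section Calculus

variable {n : Type*} [Fintype n] [DecidableEq n] {U : Set (n → ℝ)} {x : n → ℝ}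

/-! The argument separates toric Kähler geometry from Segre–Veronese algebra.

Geometry. `IsSeparableKahler` records coefficients `G_I`, closed forms `∑ θ_{Ia} dx_I`, and a matrix
`F` whose row `I` depends on `x_I` only, with `F θᵀ = diag G`. Writing `du_a = ∑ F_{Ia} dx_I`, the
base metric is `H_{ab} du_a du_b` with `H = θᵀ G⁻¹ θ`, so the whole metric is `H_{ab} (du_a du_b +
dt_a dt_b)` with holomorphic differentials `du + i dt`. Ricci curvature is therefore governed by
`log det H`. Put `C_K = ½ H⁻¹ ∂_K H`, `u_K = 2 tr C_K = ∂_K log det H` and `q_K = ∑_a (F⁻¹)_{aK} ∂_K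
F_{Ka}`. Computing with Christoffel symbols, `scalarCurvature_eq` gives `Scal = -∑ G_K⁻¹ (∂_K u_K +
u_K (u_K + q_K - ∂_K log G_K))`. An invariant `φ` is a Killing potential exactly when the torus
components of `J grad φ` are constant, that is, when `dφ` is a constant combination of the `∑ θ_{Ia}
dx_I` (`isKillingPotentialOn_iff`).

Algebra. With `w = ⟨μ, β⟩`, the pairing of `μ_β` with `ψ_I(t)` is `∏_s (t - x_{is}) ⟨x̂_i, Γ_i⟩ /
w`, which vanishes at `t = x_I`. Its first derivatives there give the duality with `F = -(ψ mod β) /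
A` (`isSeparableKahler`); its second derivative gives `q_K = ∂_K log G_K + 2 ∂_K log w`
(`frameTrace_eq`). Comparing determinants in `diag G = F H Fᵀ` yields `u_K = ∂_K log (A_K ∏_p ⟨x̂_p,
Γ_p⟩^{d_p} / w^{m+2})`. Since `w` is affine in `x_K`, the bracket in `Scal` is `p_K⁻¹ ∂_K² p_K` for
`p_K = A_K ∏_p ⟨x̂_p, Γ_p⟩^{d_p} / w^{m+1}`, which is the stated formula. Finally, a function affine
in the momenta becomes some `⟨μ, α⟩` after multiplication by `w`. -/

theorem ContDiffOn.differentiableAt_of_mem {f : (n → ℝ) → ℝ} (hf : ContDiffOn ℝ ∞ f U)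
    (hU : IsOpen U) (hx : x ∈ U) : DifferentiableAt ℝ f x :=
  (hf.contDiffAt (hU.mem_nhds hx)).differentiableAt (by simp)

theorem partialDeriv_congr (hU : IsOpen U) {f g : (n → ℝ) → ℝ} (h : Set.EqOn f g U) (hx : x ∈ U)
    (a : n) : partialDeriv a f x = partialDeriv a g x := by
  unfold partialDeriv
  rw [(h.eventuallyEq_of_mem (hU.mem_nhds hx)).fderiv_eq]

theorem ContDiffOn.partialDeriv {f : (n → ℝ) → ℝ} (hf : ContDiffOn ℝ ∞ f U) (hU : IsOpen U)
    (a : n) : ContDiffOn ℝ ∞ (_root_.partialDeriv a f) U :=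
  (hf.fderiv_of_isOpen hU (m := ∞) (by simp)).clm_apply contDiffOn_const

theorem partialDeriv_eq_zero_of_forall {f : (n → ℝ) → ℝ} {a : n}
    (h : ∀ (x : n → ℝ) (t : ℝ), f (x + t • Pi.single a (1 : ℝ)) = f x) (x : n → ℝ) : partialDeriv a f x = 0 := by
  unfold partialDeriv
  -- No smoothness is assumed: where `f` is not differentiable, `fderiv` is zero by convention.
  by_cases hf : DifferentiableAt ℝ f x
  · rw [← hf.lineDeriv_eq_fderiv, lineDeriv]
    simp [h]
  · simp [fderiv_zero_of_not_differentiableAt hf]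

theorem partialDeriv_comp_apply_of_ne {a b : n} (hab : b ≠ a) (f : ℝ → ℝ) (x : n → ℝ) :
    partialDeriv a (fun z => f (z b)) x = 0 :=
  partialDeriv_eq_zero_of_forall (fun z t => by simp [hab]) x

theorem partialDeriv_apply (a b : n) (x : n → ℝ) :
    partialDeriv a (fun z => z b) x = if b = a then 1 else 0 := by
  unfold partialDeriv
  have : (fun z : n → ℝ => z b) = ContinuousLinearMap.proj (R := ℝ) (φ := fun _ : n => ℝ) b := rfl
  rw [this, ContinuousLinearMap.fderiv]
  simp [Pi.single_apply]

theorem partialDeriv_const (a : n) (c : ℝ) (x : n → ℝ) : partialDeriv a (fun _ => c) x = 0 := by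
  simp [partialDeriv]

theorem partialDeriv_add {f g : (n → ℝ) → ℝ} (hf : DifferentiableAt ℝ f x)
    (hg : DifferentiableAt ℝ g x) (a : n) :
    partialDeriv a (fun z => f z + g z) x = partialDeriv a f x + partialDeriv a g x := by
  simp [partialDeriv, fderiv_fun_add hf hg]

theorem partialDeriv_sub {f g : (n → ℝ) → ℝ} (hf : DifferentiableAt ℝ f x)
    (hg : DifferentiableAt ℝ g x) (a : n) :
    partialDeriv a (fun z => f z - g z) x = partialDeriv a f x - partialDeriv a g x := by
  simp [partialDeriv, fderiv_fun_sub hf hg]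

theorem partialDeriv_neg (f : (n → ℝ) → ℝ) (a : n) (x : n → ℝ) :
    partialDeriv a (fun z => -f z) x = -partialDeriv a f x := by
  simp [partialDeriv, fderiv_fun_neg]

theorem partialDeriv_mul {f g : (n → ℝ) → ℝ} (hf : DifferentiableAt ℝ f x)
    (hg : DifferentiableAt ℝ g x) (a : n) :
    partialDeriv a (fun z => f z * g z) x
      = partialDeriv a f x * g x + f x * partialDeriv a g x := by
  simp [partialDeriv, fderiv_fun_mul hf hg]
  ring

theorem partialDeriv_const_mul {f : (n → ℝ) → ℝ} (c : ℝ) (hf : DifferentiableAt ℝ f x) (a : n) :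
    partialDeriv a (fun z => c * f z) x = c * partialDeriv a f x := by
  rw [partialDeriv_mul (differentiableAt_const c) hf, partialDeriv_const]
  ring

theorem partialDeriv_inv {f : (n → ℝ) → ℝ} (hf : DifferentiableAt ℝ f x) (h0 : f x ≠ 0) (a : n) :
    partialDeriv a (fun z => (f z)⁻¹) x = -partialDeriv a f x / f x ^ 2 := by
  unfold partialDeriv
  have := (hasFDerivAt_inv h0).comp x hf.hasFDerivAt
  rw [show (fun z => (f z)⁻¹) = (fun t => t⁻¹) ∘ f from rfl, this.fderiv]
  simp
  ring

theorem partialDeriv_sum {ι : Type*} (s : Finset ι) {f : ι → (n → ℝ) → ℝ}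
    (hf : ∀ i ∈ s, DifferentiableAt ℝ (f i) x) (a : n) :
    partialDeriv a (fun z => ∑ i ∈ s, f i z) x = ∑ i ∈ s, partialDeriv a (f i) x := by
  simp [partialDeriv, fderiv_fun_sum hf]

theorem partialDeriv_comm {f : (n → ℝ) → ℝ} (hf : ContDiffOn ℝ ∞ f U) (hU : IsOpen U)
    (hx : x ∈ U) (a b : n) :
    partialDeriv a (partialDeriv b f) x = partialDeriv b (partialDeriv a f) x := by
  have hd : DifferentiableAt ℝ (fderiv ℝ f) x :=
    ((hf.fderiv_of_isOpen hU (m := ∞) (by simp)).contDiffAt (hU.mem_nhds hx)).differentiableAt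
      (by simp)
  have key : ∀ a b : n, partialDeriv a (partialDeriv b f) x
      = fderiv ℝ (fderiv ℝ f) x (Pi.single a 1) (Pi.single b 1) := by
    intro a b
    unfold partialDeriv
    rw [fderiv_clm_apply hd (differentiableAt_const _)]
    simp
  rw [key, key]
  have hs : IsSymmSndFDerivAt ℝ f x :=
    (hf.contDiffAt (hU.mem_nhds hx)).isSymmSndFDerivAt (by
      rw [minSmoothness_of_isRCLikeNormedField]
      exact WithTop.coe_le_coe.mpr (le_top : (2 : ℕ∞) ≤ ⊤))
  exact hs _ _

theorem eqOn_const_of_partialDeriv_eq_zero {f : (n → ℝ) → ℝ} (hf : ContDiffOn ℝ ∞ f U)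
    (hU : IsOpen U) (hc : IsPreconnected U) (h : ∀ x ∈ U, ∀ a, partialDeriv a f x = 0) :
    ∃ c, ∀ x ∈ U, f x = c := by
  refine hU.exists_is_const_of_fderiv_eq_zero hc
    (hf.differentiableOn (by simp)) (fun x hx => ?_)
  refine ContinuousLinearMap.ext fun v => ?_
  rw [← Finset.univ_sum_single v, map_sum]
  simp only [Pi.zero_apply, _root_.zero_apply]
  refine Finset.sum_eq_zero fun a _ => ?_
  rw [show (Pi.single a (v a) : n → ℝ) = v a • Pi.single a 1 by
    rw [← Pi.single_smul]; simp, map_smul]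
  have := h x hx a
  unfold partialDeriv at this
  rw [this, smul_zero]

/-- The entrywise partial derivative of a matrix-valued function. -/
def matrixDeriv {m p : Type*} (a : n) (M : (n → ℝ) → Matrix m p ℝ) (x : n → ℝ) : Matrix m p ℝ :=
  Matrix.of fun i j => partialDeriv a (fun z => M z i j) x

/-- Entrywise smoothness of a matrix-valued function. -/
def SmoothMatrixOn {m p : Type*} (M : (n → ℝ) → Matrix m p ℝ) (U : Set (n → ℝ)) : Prop :=
  ∀ i j, ContDiffOn ℝ ∞ (fun z => M z i j) U

/-! ### Entrywise calculus of matrix-valued functions. -/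

section MatrixCalculus

variable {m p q : Type*} {M : (n → ℝ) → Matrix m p ℝ} {N : (n → ℝ) → Matrix p q ℝ}

theorem SmoothMatrixOn.mul [Fintype p] (hM : SmoothMatrixOn M U) (hN : SmoothMatrixOn N U) :
    SmoothMatrixOn (fun z => M z * N z) U := fun i j => by
  simp only [Matrix.mul_apply]
  exact ContDiffOn.sum fun k _ => (hM i k).mul (hN k j)

theorem SmoothMatrixOn.add {N : (n → ℝ) → Matrix m p ℝ} (hM : SmoothMatrixOn M U)
    (hN : SmoothMatrixOn N U) : SmoothMatrixOn (fun z => M z + N z) U := fun i j =>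
  (hM i j).add (hN i j)

theorem SmoothMatrixOn.smul (c : ℝ) (hM : SmoothMatrixOn M U) :
    SmoothMatrixOn (fun z => c • M z) U := fun i j => contDiffOn_const.mul (hM i j)

theorem SmoothMatrixOn.transpose (hM : SmoothMatrixOn M U) :
    SmoothMatrixOn (fun z => (M z).transpose) U := fun i j => hM j i

theorem SmoothMatrixOn.matrixDeriv (hM : SmoothMatrixOn M U) (hU : IsOpen U) (a : n) :
    SmoothMatrixOn (matrixDeriv a M) U := fun i j => (hM i j).partialDeriv hU a

theorem SmoothMatrixOn.trace {M : (n → ℝ) → Matrix m m ℝ} [Fintype m] (hM : SmoothMatrixOn M U) :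
    ContDiffOn ℝ ∞ (fun z => (M z).trace) U :=
  ContDiffOn.sum fun i _ => hM i i

theorem matrixDeriv_congr (hU : IsOpen U) {M N : (n → ℝ) → Matrix m p ℝ} (h : Set.EqOn M N U)
    (hx : x ∈ U) (a : n) : matrixDeriv a M x = matrixDeriv a N x := by
  ext i j
  exact partialDeriv_congr hU (fun z hz => by rw [h hz]) hx a

theorem matrixDeriv_mul [Fintype p] (hU : IsOpen U) (hx : x ∈ U) (hM : SmoothMatrixOn M U)
    (hN : SmoothMatrixOn N U) (a : n) :
    matrixDeriv a (fun z => M z * N z) x = matrixDeriv a M x * N x + M x * matrixDeriv a N x := by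
  ext i j
  have dM := fun i k => (hM i k).differentiableAt_of_mem hU hx
  have dN := fun i k => (hN i k).differentiableAt_of_mem hU hx
  simp only [matrixDeriv, Matrix.of_apply, Matrix.add_apply, Matrix.mul_apply]
  rw [partialDeriv_sum _ fun k _ => (dM i k).fun_mul (dN k j), ← Finset.sum_add_distrib]
  exact Finset.sum_congr rfl fun k _ => partialDeriv_mul (dM i k) (dN k j) a

theorem matrixDeriv_add {N : (n → ℝ) → Matrix m p ℝ} (hU : IsOpen U) (hx : x ∈ U)
    (hM : SmoothMatrixOn M U) (hN : SmoothMatrixOn N U) (a : n) :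
    matrixDeriv a (fun z => M z + N z) x = matrixDeriv a M x + matrixDeriv a N x := by
  ext i j
  exact partialDeriv_add ((hM i j).differentiableAt_of_mem hU hx)
    ((hN i j).differentiableAt_of_mem hU hx) a

theorem matrixDeriv_smul (hU : IsOpen U) (hx : x ∈ U) (c : ℝ)
    (hM : SmoothMatrixOn M U) (a : n) :
    matrixDeriv a (fun z => c • M z) x = c • matrixDeriv a M x := by
  ext i j
  exact partialDeriv_const_mul c ((hM i j).differentiableAt_of_mem hU hx) a

theorem matrixDeriv_const (C : Matrix m p ℝ) (a : n) : matrixDeriv a (fun _ => C) x = 0 := by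
  ext i j
  exact partialDeriv_const a _ x

theorem matrixDeriv_transpose (a : n) :
    matrixDeriv a (fun z => (M z).transpose) x = (matrixDeriv a M x).transpose := rfl

theorem matrixDeriv_comm (hU : IsOpen U) (hx : x ∈ U) (hM : SmoothMatrixOn M U) (a b : n) :
    matrixDeriv a (matrixDeriv b M) x = matrixDeriv b (matrixDeriv a M) x := by
  ext i j
  exact partialDeriv_comm (hM i j) hU hx a b

theorem partialDeriv_trace [Fintype m] {M : (n → ℝ) → Matrix m m ℝ} (hU : IsOpen U) (hx : x ∈ U)
    (hM : SmoothMatrixOn M U) (a : n) :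
    partialDeriv a (fun z => (M z).trace) x = (matrixDeriv a M x).trace :=
  partialDeriv_sum _ (fun i _ => (hM i i).differentiableAt_of_mem hU hx) a

/-- The derivative of a right inverse. -/
theorem matrixDeriv_of_mul_eq_one [Fintype m] [DecidableEq m] {M N : (n → ℝ) → Matrix m m ℝ}
    (hU : IsOpen U) (hx : x ∈ U) (hM : SmoothMatrixOn M U) (hN : SmoothMatrixOn N U)
    (h : ∀ z ∈ U, M z * N z = 1) (a : n) :
    matrixDeriv a N x = -(N x * matrixDeriv a M x * N x) := by
  have h1 : matrixDeriv a (fun z => M z * N z) x = 0 := by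
    rw [matrixDeriv_congr hU (N := fun _ => 1) (fun z hz => h z hz) hx, matrixDeriv_const]
  rw [matrixDeriv_mul hU hx hM hN] at h1
  have h2 : N x * M x = 1 := mul_eq_one_comm.mp (h x hx)
  calc matrixDeriv a N x = N x * (M x * matrixDeriv a N x) := by rw [← mul_assoc, h2, one_mul]
    _ = _ := by rw [eq_neg_of_add_eq_zero_right h1]; noncomm_ring

end MatrixCalculus

end Calculus

/-! ### Torus-invariant functions -/

section Invariant

variable {ι : Type*} [Fintype ι] [DecidableEq ι]

/-- The base coordinates of a point of the chart. -/
abbrev baseCoord (y : ι ⊕ ι → ℝ) : ι → ℝ := fun I => y (Sum.inl I)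

theorem continuous_baseCoord : Continuous (baseCoord : (ι ⊕ ι → ℝ) → ι → ℝ) := by
  fun_prop

theorem isOpenMap_baseCoord : IsOpenMap (baseCoord : (ι ⊕ ι → ℝ) → ι → ℝ) := by
  have : (baseCoord : (ι ⊕ ι → ℝ) → ι → ℝ)
      = (LinearMap.funLeft ℝ ℝ (Sum.inl : ι → ι ⊕ ι)) := rfl
  rw [this]
  exact LinearMap.isOpenMap_of_finiteDimensional _
    (LinearMap.funLeft_surjective_of_injective ℝ ℝ _ Sum.inl_injective)

theorem partialDeriv_inr_comp_baseCoord (f : (ι → ℝ) → ℝ) (a : ι) (y : ι ⊕ ι → ℝ) :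
    partialDeriv (Sum.inr a) (fun z => f (baseCoord z)) y = 0 :=
  partialDeriv_eq_zero_of_forall (fun z t => by
    congr 1
    ext I
    simp) y

theorem partialDeriv_inl_comp_baseCoord {f : (ι → ℝ) → ℝ} {y : ι ⊕ ι → ℝ}
    (hf : DifferentiableAt ℝ f (baseCoord y)) (I : ι) :
    partialDeriv (Sum.inl I) (fun z => f (baseCoord z)) y = partialDeriv I f (baseCoord y) := by
  unfold partialDeriv
  have hL : HasFDerivAt (baseCoord : (ι ⊕ ι → ℝ) → ι → ℝ)
      (ContinuousLinearMap.pi fun I => ContinuousLinearMap.proj (Sum.inl I)) y :=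
    (ContinuousLinearMap.pi fun I : ι => ContinuousLinearMap.proj (R := ℝ)
      (φ := fun _ : ι ⊕ ι => ℝ) (Sum.inl I)).hasFDerivAt
  have := hf.hasFDerivAt.comp y hL
  rw [show (fun z => f (baseCoord z)) = f ∘ baseCoord from rfl, this.fderiv]
  simp only [ContinuousLinearMap.comp_apply]
  congr 1
  ext J
  simp [Pi.single_apply]

end Invariant

/-! ### Curvature of separable metrics -/

section Separable

open Matrix

variable {ι : Type*} [Fintype ι] [DecidableEq ι]

/-- The data of a separable toric Kähler metric `∑_I (G_I dx_I² + G_I⁻¹ θ_I²)` with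
`θ_I = ∑_a θ_{Ia} dt_a` and holomorphic differentials `∑_I F_{Ia} dx_I + i dt_a`. -/
structure IsSeparableKahler (U : Set (ι → ℝ)) (G : ι → (ι → ℝ) → ℝ)
    (θ F : (ι → ℝ) → Matrix ι ι ℝ) : Prop where
  isOpen : IsOpen U
  smooth_G : ∀ I, ContDiffOn ℝ ∞ (G I) U
  smooth_θ : SmoothMatrixOn θ U
  smooth_F : SmoothMatrixOn F U
  G_ne_zero : ∀ x ∈ U, ∀ I, G I x ≠ 0
  duality : ∀ x ∈ U, ∀ I J, ∑ a, F x I a * θ x J a = if I = J then G I x else 0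
  closed_θ : ∀ x ∈ U, ∀ I J a,
    partialDeriv I (fun z => θ z J a) x = partialDeriv J (fun z => θ z I a) x
  separated : ∀ x ∈ U, ∀ I J a, I ≠ J → partialDeriv I (fun z => F z J a) x = 0

/-- The metric induced on the torus orbits. -/
def fibreMetric (G : ι → (ι → ℝ) → ℝ) (θ : (ι → ℝ) → Matrix ι ι ℝ) (x : ι → ℝ) : Matrix ι ι ℝ :=
  Matrix.of fun a c => ∑ I, (G I x)⁻¹ * (θ x I a * θ x I c)

/-- The metric `∑_I (G_I dx_I² + G_I⁻¹ θ_I²)`. -/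
def separableMetric (G : ι → (ι → ℝ) → ℝ) (θ : (ι → ℝ) → Matrix ι ι ℝ) (y : ι ⊕ ι → ℝ) :
    Matrix (ι ⊕ ι) (ι ⊕ ι) ℝ :=
  fromBlocks (diagonal fun I => G I (baseCoord y)) 0 0 (fibreMetric G θ (baseCoord y))

/-- The matrix `G_I⁻¹ θ_{Ia}`. -/
def frameMatrix (G : ι → (ι → ℝ) → ℝ) (θ : (ι → ℝ) → Matrix ι ι ℝ) (x : ι → ℝ) : Matrix ι ι ℝ :=
  Matrix.of fun I a => (G I x)⁻¹ * θ x I a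

/-- The inverse of the fibre metric. -/
def fibreMetricInv (G : ι → (ι → ℝ) → ℝ) (F : (ι → ℝ) → Matrix ι ι ℝ) (x : ι → ℝ) :
    Matrix ι ι ℝ :=
  (F x)ᵀ * (diagonal fun I => (G I x)⁻¹) * F x

/-- The matrix `½ H⁻¹ ∂_I H` of the connection on the torus orbits. -/
def fibreConnection (G : ι → (ι → ℝ) → ℝ) (θ F : (ι → ℝ) → Matrix ι ι ℝ) (I : ι) (x : ι → ℝ) :
    Matrix ι ι ℝ :=
  (1 / 2 : ℝ) • (fibreMetricInv G F x * matrixDeriv I (fibreMetric G θ) x)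

/-- The Christoffel symbols of the base metric. -/
def baseConnection (G : ι → (ι → ℝ) → ℝ) (θ F : (ι → ℝ) → Matrix ι ι ℝ) (I : ι) (x : ι → ℝ) :
    Matrix ι ι ℝ :=
  frameMatrix G θ x * (fibreConnection G θ F I x * (F x)ᵀ + matrixDeriv I (fun z => (F z)ᵀ) x)

namespace IsSeparableKahler

variable {U : Set (ι → ℝ)} {G : ι → (ι → ℝ) → ℝ} {θ F : (ι → ℝ) → Matrix ι ι ℝ}
  (hS : IsSeparableKahler U G θ F) {x : ι → ℝ} (hx : x ∈ U)
include hS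

theorem smooth_Ginv (I : ι) : ContDiffOn ℝ ∞ (fun z => (G I z)⁻¹) U :=
  (hS.smooth_G I).inv fun z hz => hS.G_ne_zero z hz I

theorem smooth_fibreMetric : SmoothMatrixOn (fibreMetric G θ) U := fun a c =>
  ContDiffOn.sum fun I _ => (hS.smooth_Ginv I).mul ((hS.smooth_θ I a).mul (hS.smooth_θ I c))

theorem smooth_frameMatrix : SmoothMatrixOn (frameMatrix G θ) U := fun I a =>
  (hS.smooth_Ginv I).mul (hS.smooth_θ I a)

theorem smooth_diagonal_inv : SmoothMatrixOn (fun z => diagonal fun I => (G I z)⁻¹) U :=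
  fun I J => by
    by_cases h : I = J
    · subst h; simpa using hS.smooth_Ginv I
    · simpa [h] using contDiffOn_const

theorem smooth_fibreMetricInv : SmoothMatrixOn (fibreMetricInv G F) U :=
  (hS.smooth_F.transpose.mul hS.smooth_diagonal_inv).mul hS.smooth_F

theorem smooth_fibreConnection (I : ι) : SmoothMatrixOn (fibreConnection G θ F I) U :=
  (hS.smooth_fibreMetricInv.mul (hS.smooth_fibreMetric.matrixDeriv hS.isOpen I)).smul _

theorem smooth_baseConnection (I : ι) : SmoothMatrixOn (baseConnection G θ F I) U :=
  hS.smooth_frameMatrix.mul (((hS.smooth_fibreConnection I).mul hS.smooth_F.transpose).add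
    (hS.smooth_F.transpose.matrixDeriv hS.isOpen I))

include hx

/-- Duality divided by `G_I`. This makes `frameMatrix` the inverse of `Fᵀ`, the change of frame
between `dx` and `du`. -/
theorem frame_mul_transpose : frameMatrix G θ x * (F x)ᵀ = 1 := by
  ext I J
  have h := hS.duality x hx J I
  have h0 := hS.G_ne_zero x hx I
  simp only [mul_apply, frameMatrix, of_apply, transpose_apply, mul_assoc, ← Finset.mul_sum]
  rw [show ∑ a, θ x I a * F x J a = ∑ a, F x J a * θ x I a from
    Finset.sum_congr rfl fun a _ => mul_comm _ _, h, one_apply]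
  by_cases hIJ : I = J
  · subst hIJ; simp [h0]
  · simp [hIJ, Ne.symm hIJ]

theorem transpose_mul_frame : (F x)ᵀ * frameMatrix G θ x = 1 :=
  mul_eq_one_comm.mp (hS.frame_mul_transpose hx)

theorem diagonal_mul_diagonal_inv :
    (diagonal fun I => G I x) * (diagonal fun I => (G I x)⁻¹) = 1 := by
  rw [diagonal_mul_diagonal, ← diagonal_one]
  congr 1
  ext I
  exact mul_inv_cancel₀ (hS.G_ne_zero x hx I)

theorem θ_eq : θ x = (diagonal fun I => G I x) * frameMatrix G θ x := by
  ext I a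
  simp [diagonal_mul, frameMatrix, hS.G_ne_zero x hx I]

theorem fibreMetric_eq : fibreMetric G θ x = (θ x)ᵀ * frameMatrix G θ x := by
  ext a c
  simp only [fibreMetric, mul_apply, transpose_apply, frameMatrix, of_apply]
  exact Finset.sum_congr rfl fun I _ => by ring

theorem fibreMetric_mul_transpose : fibreMetric G θ x * (F x)ᵀ = (θ x)ᵀ := by
  rw [hS.fibreMetric_eq hx, mul_assoc, hS.frame_mul_transpose hx, mul_one]

theorem fibreMetric_isSymm : (fibreMetric G θ x)ᵀ = fibreMetric G θ x := by
  ext a c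
  simp only [fibreMetric, transpose_apply, of_apply]
  exact Finset.sum_congr rfl fun I _ => by ring

/-- The base and fibre metrics agree under the change of frame `du = Fᵀ dx`: this is the
compatibility of the metric with the complex structure. -/
theorem mul_fibreMetric_mul_transpose :
    F x * fibreMetric G θ x * (F x)ᵀ = diagonal fun I => G I x := by
  rw [mul_assoc, hS.fibreMetric_mul_transpose hx, hS.θ_eq hx, transpose_mul, ← mul_assoc]
  have := congrArg transpose (hS.frame_mul_transpose hx)
  rw [transpose_mul, transpose_transpose, transpose_one] at this
  rw [this, one_mul, diagonal_transpose]

theorem fibreMetric_mul_inv : fibreMetric G θ x * fibreMetricInv G F x = 1 := by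
  have h1 : (frameMatrix G θ x)ᵀ * F x = 1 := by
    have := congrArg transpose (hS.transpose_mul_frame hx)
    simpa [transpose_mul] using this
  rw [fibreMetricInv, ← mul_assoc, ← mul_assoc, hS.fibreMetric_mul_transpose hx, hS.θ_eq hx,
    transpose_mul, diagonal_transpose, mul_assoc (frameMatrix G θ x)ᵀ,
    hS.diagonal_mul_diagonal_inv hx, mul_one, h1]

theorem inv_mul_fibreMetric : fibreMetricInv G F x * fibreMetric G θ x = 1 :=
  mul_eq_one_comm.mp (hS.fibreMetric_mul_inv hx)

theorem matrixDeriv_fibreMetric (I : ι) : matrixDeriv I (fibreMetric G θ) x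
    = (2 : ℝ) • (fibreMetric G θ x * fibreConnection G θ F I x) := by
  rw [fibreConnection, mul_smul_comm, ← mul_assoc, hS.fibreMetric_mul_inv hx, one_mul, smul_smul]
  norm_num

theorem matrixDeriv_fibreMetricInv (I : ι) : matrixDeriv I (fibreMetricInv G F) x
    = -(2 : ℝ) • (fibreConnection G θ F I x * fibreMetricInv G F x) := by
  rw [matrixDeriv_of_mul_eq_one hS.isOpen hx hS.smooth_fibreMetric hS.smooth_fibreMetricInv
    (fun z hz => hS.fibreMetric_mul_inv hz), fibreConnection, smul_mul_assoc, smul_smul]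
  norm_num

/-- The forms `du_a` are closed: by separation both sides vanish off the diagonal. -/
theorem matrixDeriv_F_symm (I J a : ι) :
    matrixDeriv I (fun z => (F z)ᵀ) x a J = matrixDeriv J (fun z => (F z)ᵀ) x a I := by
  by_cases h : I = J
  · rw [h]
  · simp only [matrixDeriv, transpose_apply, of_apply]
    rw [hS.separated x hx I J a h, hS.separated x hx J I a (Ne.symm h)]

/-- Differentiate `H Fᵀ = θᵀ`: the derivatives of `θ` are symmetric by closedness and those of `F`
by separation. In the coordinates `u` this says that `H` is a Hessian. -/
theorem matrixDeriv_fibreMetric_mul_symm (I J a : ι) :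
    (matrixDeriv I (fibreMetric G θ) x * (F x)ᵀ) a J
      = (matrixDeriv J (fibreMetric G θ) x * (F x)ᵀ) a I := by
  have key : ∀ I J, (matrixDeriv I (fibreMetric G θ) x * (F x)ᵀ) a J
      = partialDeriv I (fun z => θ z J a) x
        - ∑ c, fibreMetric G θ x a c * matrixDeriv I (fun z => (F z)ᵀ) x c J := by
    intro I J
    have h := matrixDeriv_mul hS.isOpen hx hS.smooth_fibreMetric hS.smooth_F.transpose I
    rw [matrixDeriv_congr hS.isOpen (N := fun z => (θ z)ᵀ)
      (fun z hz => hS.fibreMetric_mul_transpose hz) hx] at h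
    have h' := congrFun (congrFun h a) J
    rw [Matrix.add_apply, mul_apply (M := fibreMetric G θ x)] at h'
    rw [eq_sub_iff_add_eq, ← h']
    rfl
  rw [key, key, hS.closed_θ x hx I J]
  simp_rw [hS.matrixDeriv_F_symm hx I J]

theorem fibreConnection_mul_symm (I J a : ι) :
    (fibreConnection G θ F I x * (F x)ᵀ) a J = (fibreConnection G θ F J x * (F x)ᵀ) a I := by
  simp only [fibreConnection, smul_mul_assoc, Matrix.smul_apply, mul_assoc]
  rw [mul_apply, mul_apply]
  simp_rw [hS.matrixDeriv_fibreMetric_mul_symm hx I J]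

theorem baseConnection_symm (I J K : ι) :
    baseConnection G θ F I x K J = baseConnection G θ F J x K I := by
  simp only [baseConnection]
  rw [mul_apply, mul_apply]
  refine Finset.sum_congr rfl fun a _ => ?_
  rw [Matrix.add_apply, Matrix.add_apply, hS.fibreConnection_mul_symm hx I J,
    hS.matrixDeriv_F_symm hx I J]

end IsSeparableKahler

end Separable

/-! ### Christoffel symbols of a separable metric. -/

section SeparableChristoffel

open Matrix

namespace IsSeparableKahler

variable {ι : Type*} [Fintype ι] [DecidableEq ι] {U : Set (ι → ℝ)} {G : ι → (ι → ℝ) → ℝ}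
  {θ F : (ι → ℝ) → Matrix ι ι ℝ} (hS : IsSeparableKahler U G θ F) {y : ι ⊕ ι → ℝ}
  (hy : baseCoord y ∈ U)
include hS

theorem smooth_diagonal : SmoothMatrixOn (fun z => diagonal fun I => G I z) U :=
  fun I J => by
    by_cases h : I = J
    · subst h; simpa using hS.smooth_G I
    · simpa [h] using contDiffOn_const

include hy

theorem separableMetric_inv : (separableMetric G θ y)⁻¹
    = fromBlocks (diagonal fun I => (G I (baseCoord y))⁻¹) 0 0
        (fibreMetricInv G F (baseCoord y)) := by
  apply inv_eq_right_inv
  rw [separableMetric, fromBlocks_multiply]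
  simp only [mul_zero, zero_mul, add_zero, zero_add]
  rw [hS.diagonal_mul_diagonal_inv hy, hS.fibreMetric_mul_inv hy, fromBlocks_one]

theorem partialDeriv_metric_inl_inl (I J K : ι) :
    partialDeriv (Sum.inl I) (fun z => separableMetric G θ z (Sum.inl J) (Sum.inl K)) y
      = matrixDeriv I (fun z => diagonal fun I => G I z) (baseCoord y) J K := by
  simp only [separableMetric, fromBlocks_apply₁₁]
  exact partialDeriv_inl_comp_baseCoord (f := fun x => diagonal (fun I => G I x) J K)
    ((hS.smooth_diagonal J K).differentiableAt_of_mem hS.isOpen hy) I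

theorem partialDeriv_metric_inr_inr (I a c : ι) :
    partialDeriv (Sum.inl I) (fun z => separableMetric G θ z (Sum.inr a) (Sum.inr c)) y
      = matrixDeriv I (fibreMetric G θ) (baseCoord y) a c := by
  simp only [separableMetric, fromBlocks_apply₂₂]
  exact partialDeriv_inl_comp_baseCoord (f := fun x => fibreMetric G θ x a c)
    ((hS.smooth_fibreMetric a c).differentiableAt_of_mem hS.isOpen hy) I

omit hS hy in
theorem partialDeriv_metric_inl_inr (p : ι ⊕ ι) (J c : ι) :
    partialDeriv p (fun z => separableMetric G θ z (Sum.inl J) (Sum.inr c)) y = 0 := by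
  simp only [separableMetric, fromBlocks_apply₁₂, Matrix.zero_apply]
  exact partialDeriv_const _ _ _

omit hS hy in
theorem partialDeriv_metric_inr_inl (p : ι ⊕ ι) (J c : ι) :
    partialDeriv p (fun z => separableMetric G θ z (Sum.inr c) (Sum.inl J)) y = 0 := by
  simp only [separableMetric, fromBlocks_apply₂₁, Matrix.zero_apply]
  exact partialDeriv_const _ _ _

omit hS hy in
theorem partialDeriv_inr_metric (a : ι) (p q : ι ⊕ ι) :
    partialDeriv (Sum.inr a) (fun z => separableMetric G θ z p q) y = 0 :=
  partialDeriv_inr_comp_baseCoord (fun x => fromBlocks (diagonal fun I => G I x) 0 0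
    (fibreMetric G θ x) p q) a y

/-- The metric is invariant under `t ↦ -t`, so symbols with an odd number of torus indices vanish;
this covers the next three lemmas too. In the names, the upper index comes first. -/
theorem christoffel_xtx (K I c : ι) :
    christoffel (separableMetric G θ) (Sum.inl K) (Sum.inl I) (Sum.inr c) y = 0 := by
  simp [christoffel, hS.separableMetric_inv hy, partialDeriv_metric_inr_inl,
    partialDeriv_inr_metric, partialDeriv_metric_inl_inr]

theorem christoffel_xxt (K I c : ι) :
    christoffel (separableMetric G θ) (Sum.inl K) (Sum.inr c) (Sum.inl I) y = 0 := by
  simp [christoffel, hS.separableMetric_inv hy, partialDeriv_metric_inr_inl,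
    partialDeriv_inr_metric]

theorem christoffel_txx (a I J : ι) :
    christoffel (separableMetric G θ) (Sum.inr a) (Sum.inl I) (Sum.inl J) y = 0 := by
  simp [christoffel, hS.separableMetric_inv hy, 
    partialDeriv_inr_metric, partialDeriv_metric_inl_inr]

theorem christoffel_ttt (a b c : ι) :
    christoffel (separableMetric G θ) (Sum.inr a) (Sum.inr b) (Sum.inr c) y = 0 := by
  simp [christoffel, hS.separableMetric_inv hy, partialDeriv_inr_metric]

theorem christoffel_xtt (K a c : ι) :
    christoffel (separableMetric G θ) (Sum.inl K) (Sum.inr a) (Sum.inr c) y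
      = -(1 / 2) * ((G K (baseCoord y))⁻¹
        * matrixDeriv K (fibreMetric G θ) (baseCoord y) a c) := by
  simp [christoffel, hS.separableMetric_inv hy, partialDeriv_inr_metric,
    diagonal_apply,
    hS.partialDeriv_metric_inr_inr hy]

theorem christoffel_txt (a I c : ι) :
    christoffel (separableMetric G θ) (Sum.inr a) (Sum.inl I) (Sum.inr c) y
      = fibreConnection G θ F I (baseCoord y) a c := by
  have hsymm : ∀ l, matrixDeriv I (fibreMetric G θ) (baseCoord y) c l
      = matrixDeriv I (fibreMetric G θ) (baseCoord y) l c := fun l =>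
    partialDeriv_congr hS.isOpen
      (fun z hz => congrFun (congrFun (hS.fibreMetric_isSymm hz) l) c) hy I
  simp [christoffel, hS.separableMetric_inv hy, partialDeriv_metric_inr_inl,
    partialDeriv_inr_metric, partialDeriv_metric_inl_inr,
    hS.partialDeriv_metric_inr_inr hy, fibreConnection, mul_apply, hsymm]

theorem christoffel_ttx (a I c : ι) :
    christoffel (separableMetric G θ) (Sum.inr a) (Sum.inr c) (Sum.inl I) y
      = fibreConnection G θ F I (baseCoord y) a c := by
  rw [← hS.christoffel_txt hy]
  have hsymm : ∀ l c, matrixDeriv I (fibreMetric G θ) (baseCoord y) c l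
      = matrixDeriv I (fibreMetric G θ) (baseCoord y) l c := fun l c =>
    partialDeriv_congr hS.isOpen
      (fun z hz => congrFun (congrFun (hS.fibreMetric_isSymm hz) l) c) hy I
  simp [christoffel, hS.separableMetric_inv hy, partialDeriv_metric_inr_inl,
    partialDeriv_inr_metric, partialDeriv_metric_inl_inr,
    hS.partialDeriv_metric_inr_inr hy]

/-- Differentiating `diag G = F H Fᵀ` gives `Nᵀ + T + N`. In the Koszul combination the total
symmetry of `T` leaves one copy of `T`, and the symmetry of `N` in derivative and column index
leaves two copies of `N`. -/
theorem christoffel_xxx (K I J : ι) :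
    christoffel (separableMetric G θ) (Sum.inl K) (Sum.inl I) (Sum.inl J) y
      = baseConnection G θ F I (baseCoord y) K J := by
  set x := baseCoord y with hxdef
  let T : ι → Matrix ι ι ℝ := fun I => F x * (matrixDeriv I (fibreMetric G θ) x * (F x)ᵀ)
  let N : ι → Matrix ι ι ℝ := fun I => F x * fibreMetric G θ x * matrixDeriv I (fun z => (F z)ᵀ) x
  have hHT : ∀ I, (matrixDeriv I (fibreMetric G θ) x)ᵀ = matrixDeriv I (fibreMetric G θ) x :=
    fun I => (matrixDeriv_transpose I).symm.trans
      (matrixDeriv_congr hS.isOpen (fun z hz => hS.fibreMetric_isSymm hz) hy I)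
  have hdG : ∀ I, matrixDeriv I (fun z => diagonal fun I => G I z) x = (N I)ᵀ + T I + N I := by
    intro I
    rw [matrixDeriv_congr hS.isOpen (N := fun z => F z * fibreMetric G θ z * (F z)ᵀ)
      (fun z hz => (hS.mul_fibreMetric_mul_transpose hz).symm) hy,
      matrixDeriv_mul hS.isOpen hy (hS.smooth_F.mul hS.smooth_fibreMetric) hS.smooth_F.transpose,
      matrixDeriv_mul hS.isOpen hy hS.smooth_F hS.smooth_fibreMetric]
    simp only [N, T, transpose_mul, hS.fibreMetric_isSymm hy, matrixDeriv_transpose,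
      transpose_transpose]
    noncomm_ring
  have hB : G K x * baseConnection G θ F I x K J = 1 / 2 * T I K J + N I K J := by
    have h1 : (diagonal fun I => G I x) * frameMatrix G θ x = F x * fibreMetric G θ x := by
      rw [← hS.θ_eq hy]
      have := congrArg transpose (hS.fibreMetric_mul_transpose hy)
      rw [transpose_mul, transpose_transpose, transpose_transpose, hS.fibreMetric_isSymm hy] at this
      exact this.symm
    have h2 : (diagonal fun I => G I x) * baseConnection G θ F I x
        = (1 / 2 : ℝ) • T I + N I := by
      rw [baseConnection, ← mul_assoc, h1, mul_add, fibreConnection]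
      simp only [smul_mul_assoc, mul_smul_comm, T, N]
      congr 2
      rw [mul_assoc (F x), mul_assoc (fibreMetricInv G F x),
        ← mul_assoc (fibreMetric G θ x) (fibreMetricInv G F x),
        hS.fibreMetric_mul_inv hy, one_mul]
    have h3 := congrFun (congrFun h2 K) J
    rw [diagonal_mul] at h3
    rw [h3]
    rfl
  have hNs : ∀ I J K, N I K J = N J K I := fun I J K => by
    simp only [N]
    rw [mul_apply, mul_apply]
    simp_rw [hS.matrixDeriv_F_symm hy I J]
  have hTs : ∀ I J K, T I K J = T J K I := fun I J K => by
    simp only [T]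
    rw [mul_apply, mul_apply]
    simp_rw [hS.matrixDeriv_fibreMetric_mul_symm hy I J]
  have hTt : ∀ I J K, T I K J = T I J K := fun I J K => by
    have : (T I)ᵀ = T I := by
      simp only [T, transpose_mul, transpose_transpose, hHT, mul_assoc]
    exact congrFun (congrFun this J) K
  have hG0 := hS.G_ne_zero x hy K
  refine mul_left_cancel₀ hG0 ?_
  rw [hB]
  simp only [christoffel, hS.separableMetric_inv hy, Fintype.sum_sum_type, fromBlocks_apply₁₁,
    fromBlocks_apply₁₂, Matrix.zero_apply, zero_mul, Finset.sum_const_zero, add_zero, diagonal_apply,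
    hS.partialDeriv_metric_inl_inl hy, ite_mul, Finset.sum_ite_eq, Finset.mem_univ, if_true]
  rw [← hxdef, hdG, hdG, hdG]
  simp only [Matrix.add_apply, transpose_apply]
  have e1 : N I J K = N K J I := hNs I K J
  have e2 : N J I K = N K I J := hNs J K I
  have e3 : N J K I = N I K J := hNs J I K
  have e4 : T J I K = T I K J := by rw [hTt J K I, hTs J I K]
  have e5 : T K I J = T I K J := by rw [hTt K J I, hTs K I J, hTt I K J]
  have e6 : T I J K = T I K J := hTt I K J
  rw [e1, e2, e3, e4, e5, e6]
  field_simp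
  ring

end IsSeparableKahler

end SeparableChristoffel

/-! ### The base and torus blocks of the Ricci tensor. -/

section SeparableCurvature

open Matrix

namespace IsSeparableKahler

variable {ι : Type*} [Fintype ι] [DecidableEq ι] {U : Set (ι → ℝ)} {G : ι → (ι → ℝ) → ℝ}
  {θ F : (ι → ℝ) → Matrix ι ι ℝ} (hS : IsSeparableKahler U G θ F) {y : ι ⊕ ι → ℝ}
  (hy : baseCoord y ∈ U) {x : ι → ℝ} (hx : x ∈ U)
include hS

theorem partialDeriv_inl_of_eq (hy : baseCoord y ∈ U) {f : (ι ⊕ ι → ℝ) → ℝ} {φ : (ι → ℝ) → ℝ}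
    (hφ : ContDiffOn ℝ ∞ φ U) (h : ∀ z, baseCoord z ∈ U → f z = φ (baseCoord z)) (I : ι) :
    partialDeriv (Sum.inl I) f y = partialDeriv I φ (baseCoord y) := by
  rw [← partialDeriv_inl_comp_baseCoord (hφ.differentiableAt_of_mem hS.isOpen hy)]
  exact partialDeriv_congr (hS.isOpen.preimage continuous_baseCoord) (fun z hz => h z hz) hy _

theorem partialDeriv_inr_of_eq (hy : baseCoord y ∈ U) {f : (ι ⊕ ι → ℝ) → ℝ} {φ : (ι → ℝ) → ℝ}
    (h : ∀ z, baseCoord z ∈ U → f z = φ (baseCoord z)) (a : ι) :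
    partialDeriv (Sum.inr a) f y = 0 := by
  rw [← partialDeriv_inr_comp_baseCoord φ a y]
  exact partialDeriv_congr (hS.isOpen.preimage continuous_baseCoord) (fun z hz => h z hz) hy _

include hy in
theorem ricci_inl_inl (J I : ι) :
    ricciCurvature (separableMetric G θ) (Sum.inl J) (Sum.inl I) y
      = ∑ K, (matrixDeriv K (baseConnection G θ F I) (baseCoord y)
          - matrixDeriv I (baseConnection G θ F K) (baseCoord y)
          + baseConnection G θ F K (baseCoord y) * baseConnection G θ F I (baseCoord y)
          - baseConnection G θ F I (baseCoord y) * baseConnection G θ F K (baseCoord y)) K J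
        + (-partialDeriv I (fun z => (fibreConnection G θ F J z).trace) (baseCoord y)
          + ∑ L, (fibreConnection G θ F L (baseCoord y)).trace
            * baseConnection G θ F I (baseCoord y) L J
          - (fibreConnection G θ F I (baseCoord y) * fibreConnection G θ F J (baseCoord y)).trace)
      := by
  rw [ricciCurvature, Fintype.sum_sum_type]
  congr 1
  -- Tracing over base directions gives the curvature of the base connection; the torus directions
  -- supply the trace terms.
  · refine Finset.sum_congr rfl fun K _ => ?_
    rw [riemannCurvature, Fintype.sum_sum_type]
    rw [hS.partialDeriv_inl_of_eq hy (hS.smooth_baseConnection I K J)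
      (fun z hz => hS.christoffel_xxx hz K I J),
      hS.partialDeriv_inl_of_eq hy (hS.smooth_baseConnection K K J)
      (fun z hz => hS.christoffel_xxx hz K K J)]
    simp only [hS.christoffel_xxx hy, hS.christoffel_xtx hy, hS.christoffel_txx hy, zero_mul,
      sub_zero, Finset.sum_const_zero, add_zero, Finset.sum_sub_distrib]
    simp only [Matrix.add_apply, Matrix.sub_apply, mul_apply, matrixDeriv, of_apply]
    ring
  · have h1 : ∀ a, riemannCurvature (separableMetric G θ) (Sum.inr a) (Sum.inl J) (Sum.inr a)
        (Sum.inl I) y = -partialDeriv I (fun z => fibreConnection G θ F J z a a) (baseCoord y)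
          + ∑ L, fibreConnection G θ F L (baseCoord y) a a
            * baseConnection G θ F I (baseCoord y) L J
          - ∑ c, fibreConnection G θ F I (baseCoord y) a c
            * fibreConnection G θ F J (baseCoord y) c a := by
      intro a
      rw [riemannCurvature, Fintype.sum_sum_type]
      rw [hS.partialDeriv_inr_of_eq hy (φ := fun _ => 0) (fun z hz => hS.christoffel_txx hz a I J),
        hS.partialDeriv_inl_of_eq hy (hS.smooth_fibreConnection J a a)
        (fun z hz => hS.christoffel_ttx hz a J a)]
      simp only [hS.christoffel_xxx hy, hS.christoffel_ttx hy, hS.christoffel_txx hy,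
        hS.christoffel_ttt hy, hS.christoffel_txt hy, zero_mul, sub_zero, zero_sub,
        Finset.sum_neg_distrib]
      ring
    simp only [h1, Finset.sum_sub_distrib, Finset.sum_add_distrib, Finset.sum_neg_distrib]
    congr 1
    congr 1
    · rw [show (fun z => (fibreConnection G θ F J z).trace)
        = fun z => ∑ a, fibreConnection G θ F J z a a from rfl,
        partialDeriv_sum _ fun a _ =>
          (hS.smooth_fibreConnection J a a).differentiableAt_of_mem hS.isOpen hy]
    · rw [Finset.sum_comm]
      simp only [trace, diag_apply, Finset.sum_mul]

include hy in
theorem ricci_inr_inr (c b : ι) :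
    ricciCurvature (separableMetric G θ) (Sum.inr c) (Sum.inr b) y
      = ∑ K, (partialDeriv K (fun z => -(1 / 2) * ((G K z)⁻¹
              * matrixDeriv K (fibreMetric G θ) z b c)) (baseCoord y)
          - (1 / 2) * ((G K (baseCoord y))⁻¹ * matrixDeriv K (fibreMetric G θ) (baseCoord y) b c)
            * ((∑ L, baseConnection G θ F L (baseCoord y) L K)
              + (fibreConnection G θ F K (baseCoord y)).trace)
          + (1 / 2) * (G K (baseCoord y))⁻¹ *
            ((matrixDeriv K (fibreMetric G θ) (baseCoord y)
              * fibreConnection G θ F K (baseCoord y)) b c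
            + ((fibreConnection G θ F K (baseCoord y))ᵀ
              * matrixDeriv K (fibreMetric G θ) (baseCoord y)) b c)) := by
  have hK : ∀ K, riemannCurvature (separableMetric G θ) (Sum.inl K) (Sum.inr c) (Sum.inl K)
      (Sum.inr b) y = partialDeriv K (fun z => -(1 / 2) * ((G K z)⁻¹
              * matrixDeriv K (fibreMetric G θ) z b c)) (baseCoord y)
        + ∑ L, baseConnection G θ F K (baseCoord y) K L * (-(1 / 2) * ((G L (baseCoord y))⁻¹
          * matrixDeriv L (fibreMetric G θ) (baseCoord y) b c))
        - ∑ f, (-(1 / 2) * ((G K (baseCoord y))⁻¹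
          * matrixDeriv K (fibreMetric G θ) (baseCoord y) b f))
            * fibreConnection G θ F K (baseCoord y) f c := by
    intro K
    rw [riemannCurvature, Fintype.sum_sum_type]
    rw [hS.partialDeriv_inl_of_eq hy (contDiffOn_const.mul ((hS.smooth_Ginv K).mul
        (hS.smooth_fibreMetric.matrixDeriv hS.isOpen K b c)))
      (fun z hz => hS.christoffel_xtt hz K b c),
      hS.partialDeriv_inr_of_eq hy (φ := fun _ => 0) (fun z hz => hS.christoffel_xtx hz K K c)]
    simp only [hS.christoffel_xxx hy, hS.christoffel_xxt hy, hS.christoffel_xtx hy,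
      hS.christoffel_xtt hy, hS.christoffel_txt hy, zero_mul, sub_zero, zero_sub,
      Finset.sum_neg_distrib]
    ring
  have he : ∀ e, riemannCurvature (separableMetric G θ) (Sum.inr e) (Sum.inr c) (Sum.inr e)
      (Sum.inr b) y = ∑ L, (fibreConnection G θ F L (baseCoord y) e e
          * (-(1 / 2) * ((G L (baseCoord y))⁻¹
          * matrixDeriv L (fibreMetric G θ) (baseCoord y) b c))
        - fibreConnection G θ F L (baseCoord y) e b
          * (-(1 / 2) * ((G L (baseCoord y))⁻¹
          * matrixDeriv L (fibreMetric G θ) (baseCoord y) e c))) := by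
    intro e
    rw [riemannCurvature, Fintype.sum_sum_type]
    rw [hS.partialDeriv_inr_of_eq hy (φ := fun _ => 0) (fun z hz => hS.christoffel_ttt hz e b c),
      hS.partialDeriv_inr_of_eq hy (φ := fun _ => 0) (fun z hz => hS.christoffel_ttt hz e e c)]
    simp only [hS.christoffel_ttt hy, hS.christoffel_ttx hy, hS.christoffel_xtt hy, zero_mul,
      sub_self, Finset.sum_const_zero, add_zero, zero_add]
  rw [ricciCurvature, Fintype.sum_sum_type]
  simp only [hK, he]
  rw [Finset.sum_comm (s := Finset.univ) (t := Finset.univ) (f := fun e L =>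
    (fibreConnection G θ F L (baseCoord y) e e * (-(1 / 2) * ((G L (baseCoord y))⁻¹
          * matrixDeriv L (fibreMetric G θ) (baseCoord y) b c))
        - fibreConnection G θ F L (baseCoord y) e b * (-(1 / 2) * ((G L (baseCoord y))⁻¹
          * matrixDeriv L (fibreMetric G θ) (baseCoord y) e c))))]
  simp only [Finset.sum_sub_distrib, Finset.sum_add_distrib]
  rw [Finset.sum_comm (s := Finset.univ) (t := Finset.univ) (f := fun K L =>
    baseConnection G θ F K (baseCoord y) K L * (-(1 / 2) * ((G L (baseCoord y))⁻¹
          * matrixDeriv L (fibreMetric G θ) (baseCoord y) b c)))]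
  simp only [← Finset.sum_sub_distrib, ← Finset.sum_add_distrib]
  refine Finset.sum_congr rfl fun K _ => ?_
  simp only [mul_apply, trace, diag_apply, transpose_apply, mul_assoc, ← Finset.sum_mul,
    ← Finset.mul_sum, Finset.sum_sub_distrib]
  have h1 : ∑ i, fibreConnection G θ F K (baseCoord y) i b * (-(1 / 2) * ((G K (baseCoord y))⁻¹
      * matrixDeriv K (fibreMetric G θ) (baseCoord y) i c))
      = -(1 / 2) * ((G K (baseCoord y))⁻¹ * ∑ i, fibreConnection G θ F K (baseCoord y) i b
        * matrixDeriv K (fibreMetric G θ) (baseCoord y) i c) := by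
    simp only [Finset.mul_sum]
    exact Finset.sum_congr rfl fun i _ => by ring
  rw [h1]
  ring

end IsSeparableKahler

end SeparableCurvature

/-! ### Simplification of the Ricci tensor and the scalar curvature. -/

section SeparableScalar

open Matrix

/-- The diagonal coefficient `∑_a (F⁻¹)_{aK} ∂_K F_{Ka}`. -/
def frameTrace {ι : Type*} [Fintype ι] [DecidableEq ι] (G : ι → (ι → ℝ) → ℝ)
    (θ F : (ι → ℝ) → Matrix ι ι ℝ) (K : ι) (x : ι → ℝ) : ℝ :=
  (frameMatrix G θ x * matrixDeriv K (fun z => (F z)ᵀ) x) K K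

namespace IsSeparableKahler

variable {ι : Type*} [Fintype ι] [DecidableEq ι] {U : Set (ι → ℝ)} {G : ι → (ι → ℝ) → ℝ}
  {θ F : (ι → ℝ) → Matrix ι ι ℝ} (hS : IsSeparableKahler U G θ F) {y : ι ⊕ ι → ℝ}
  (hy : baseCoord y ∈ U) {x : ι → ℝ} (hx : x ∈ U)
include hS hx

theorem matrixDeriv_fibreConnection (K I : ι) : matrixDeriv K (fibreConnection G θ F I) x
    = -(2 : ℝ) • (fibreConnection G θ F K x * fibreConnection G θ F I x)
      + (1 / 2 : ℝ) • (fibreMetricInv G F x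
        * matrixDeriv K (matrixDeriv I (fibreMetric G θ)) x) := by
  have h : matrixDeriv K (fibreConnection G θ F I) x = _ :=
    matrixDeriv_smul hS.isOpen hx (1 / 2 : ℝ)
      (hS.smooth_fibreMetricInv.mul (hS.smooth_fibreMetric.matrixDeriv hS.isOpen I)) K
  rw [h, matrixDeriv_mul hS.isOpen hx hS.smooth_fibreMetricInv
    (hS.smooth_fibreMetric.matrixDeriv hS.isOpen I), hS.matrixDeriv_fibreMetricInv hx, smul_add]
  congr 1
  rw [smul_mul_assoc, fibreConnection, fibreConnection, mul_smul_comm, smul_comm, mul_assoc]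

/-- The second derivatives of `H` cancel by symmetry; only the products from differentiating `H⁻¹`
remain. -/
theorem fibreConnection_curvature (K I : ι) :
    matrixDeriv K (fibreConnection G θ F I) x - matrixDeriv I (fibreConnection G θ F K) x
      = (2 : ℝ) • (fibreConnection G θ F I x * fibreConnection G θ F K x
        - fibreConnection G θ F K x * fibreConnection G θ F I x) := by
  rw [hS.matrixDeriv_fibreConnection hx, hS.matrixDeriv_fibreConnection hx,
    matrixDeriv_comm hS.isOpen hx hS.smooth_fibreMetric I K]
  module

/-- The base connection is the gauge transform of `C` by `Fᵀ`, so its curvature is conjugate to that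
of `C`. The latter is `2[C_I, C_K] + [C_K, C_I] = [C_I, C_K]`. -/
theorem baseConnection_curvature (K I : ι) :
    matrixDeriv K (baseConnection G θ F I) x - matrixDeriv I (baseConnection G θ F K) x
      + baseConnection G θ F K x * baseConnection G θ F I x
      - baseConnection G θ F I x * baseConnection G θ F K x
      = frameMatrix G θ x * (fibreConnection G θ F I x * fibreConnection G θ F K x
        - fibreConnection G θ F K x * fibreConnection G θ F I x) * (F x)ᵀ := by
  have hT := hS.smooth_F.transpose
  have hdR : ∀ K, matrixDeriv K (frameMatrix G θ) x
      = -(frameMatrix G θ x * matrixDeriv K (fun z => (F z)ᵀ) x * frameMatrix G θ x) :=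
    fun K => matrixDeriv_of_mul_eq_one hS.isOpen hx hT hS.smooth_frameMatrix
      (fun z hz => hS.transpose_mul_frame hz) K
  have hdB : ∀ K I, matrixDeriv K (baseConnection G θ F I) x
      = -(frameMatrix G θ x * matrixDeriv K (fun z => (F z)ᵀ) x * frameMatrix G θ x)
          * (fibreConnection G θ F I x * (F x)ᵀ + matrixDeriv I (fun z => (F z)ᵀ) x)
        + frameMatrix G θ x * (matrixDeriv K (fibreConnection G θ F I) x * (F x)ᵀ
          + fibreConnection G θ F I x * matrixDeriv K (fun z => (F z)ᵀ) x
          + matrixDeriv K (matrixDeriv I (fun z => (F z)ᵀ)) x) := by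
    intro K I
    have hC := hS.smooth_fibreConnection I
    have hd := hT.matrixDeriv hS.isOpen I
    have h : matrixDeriv K (baseConnection G θ F I) x = _ := matrixDeriv_mul hS.isOpen hx
      hS.smooth_frameMatrix ((hC.mul hT).add hd) K
    rw [h, hdR, matrixDeriv_add hS.isOpen hx (hC.mul hT) hd, matrixDeriv_mul hS.isOpen hx hC hT]
  have hcurv := hS.fibreConnection_curvature hx K I
  have hLR := hS.transpose_mul_frame hx
  rw [hdB K I, hdB I K, matrixDeriv_comm hS.isOpen hx hT I K, baseConnection, baseConnection]
  -- What is left is a noncommutative identity that uses only `L * R = 1` and the curvature of `C`.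
  generalize frameMatrix G θ x = R at *
  generalize (F x)ᵀ = L at *
  generalize matrixDeriv K (matrixDeriv I (fun z => (F z)ᵀ)) x = D at *
  generalize matrixDeriv K (fun z => (F z)ᵀ) x = LK at *
  generalize matrixDeriv I (fun z => (F z)ᵀ) x = LI at *
  generalize fibreConnection G θ F I x = CI at *
  generalize fibreConnection G θ F K x = CK at *
  rw [sub_eq_iff_eq_add] at hcurv
  rw [hcurv]
  have h1 : R * (CK * L + LK) * (R * (CI * L + LI))
      = R * CK * CI * L + R * CK * LI + R * LK * R * (CI * L + LI) := by
    calc _ = R * CK * (L * R) * (CI * L + LI) + R * LK * R * (CI * L + LI) := by noncomm_ring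
      _ = _ := by rw [hLR]; noncomm_ring
  have h2 : R * (CI * L + LI) * (R * (CK * L + LK))
      = R * CI * CK * L + R * CI * LK + R * LI * R * (CK * L + LK) := by
    calc _ = R * CI * (L * R) * (CK * L + LK) + R * LI * R * (CK * L + LK) := by noncomm_ring
      _ = _ := by rw [hLR]; noncomm_ring
  rw [h1, h2, two_smul]
  noncomm_ring

/-- The symmetry of `C_K Fᵀ` exchanges `K` and `J`, turning the sum into a trace in which the
conjugation by `Fᵀ` drops out. With the next lemma, this cancels the quadratic terms in the base
block of Ricci. -/
theorem sum_frame_mul_fibreConnection (I J : ι) :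
    ∑ K, (frameMatrix G θ x * (fibreConnection G θ F I x * fibreConnection G θ F K x)
      * (F x)ᵀ) K J = (fibreConnection G θ F I x * fibreConnection G θ F J x).trace := by
  have h : ∀ K, (frameMatrix G θ x * (fibreConnection G θ F I x * fibreConnection G θ F K x)
      * (F x)ᵀ) K J = (frameMatrix G θ x * fibreConnection G θ F I x
        * (fibreConnection G θ F J x * (F x)ᵀ)) K K := by
    intro K
    rw [← mul_assoc, mul_assoc (frameMatrix G θ x * _), mul_apply, mul_apply]
    simp_rw [hS.fibreConnection_mul_symm hx K J]
  simp_rw [h]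
  change trace _ = _
  rw [← mul_assoc, trace_mul_comm, ← mul_assoc, ← mul_assoc, hS.transpose_mul_frame hx, one_mul]

theorem sum_frame_mul_fibreConnection' (I J : ι) :
    ∑ K, (frameMatrix G θ x * (fibreConnection G θ F K x * fibreConnection G θ F I x)
      * (F x)ᵀ) K J = ∑ L, (fibreConnection G θ F L x).trace
        * (frameMatrix G θ x * (fibreConnection G θ F I x * (F x)ᵀ)) L J := by
  have h : ∀ K, (frameMatrix G θ x * (fibreConnection G θ F K x * fibreConnection G θ F I x)
      * (F x)ᵀ) K J = ∑ L, (frameMatrix G θ x * (fibreConnection G θ F L x * (F x)ᵀ)) K K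
        * (frameMatrix G θ x * (fibreConnection G θ F I x * (F x)ᵀ)) L J := by
    intro K
    have : frameMatrix G θ x * (fibreConnection G θ F K x * fibreConnection G θ F I x) * (F x)ᵀ
        = frameMatrix G θ x * (fibreConnection G θ F K x * (F x)ᵀ)
          * (frameMatrix G θ x * (fibreConnection G θ F I x * (F x)ᵀ)) := by
      calc _ = frameMatrix G θ x * fibreConnection G θ F K x * 1
            * (fibreConnection G θ F I x * (F x)ᵀ) := by noncomm_ring
        _ = _ := by rw [← hS.transpose_mul_frame hx]; noncomm_ring
    rw [this, mul_apply]
    refine Finset.sum_congr rfl fun L _ => ?_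
    congr 1
    rw [mul_apply, mul_apply]
    simp_rw [hS.fibreConnection_mul_symm hx K L]
  simp_rw [h]
  rw [Finset.sum_comm]
  refine Finset.sum_congr rfl fun L _ => ?_
  rw [← Finset.sum_mul]
  congr 1
  change trace _ = _
  rw [← mul_assoc, trace_mul_comm, ← mul_assoc, hS.transpose_mul_frame hx, one_mul]

theorem frame_mul_matrixDeriv_diag_eq_zero {K L : ι} (h : K ≠ L) :
    (frameMatrix G θ x * matrixDeriv K (fun z => (F z)ᵀ) x) L L = 0 := by
  rw [mul_apply]
  refine Finset.sum_eq_zero fun a _ => ?_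
  rw [show matrixDeriv K (fun z => (F z)ᵀ) x a L = 0 from hS.separated x hx K L a h, mul_zero]

theorem trace_frame_mul_matrixDeriv (K : ι) :
    (frameMatrix G θ x * matrixDeriv K (fun z => (F z)ᵀ) x).trace = frameTrace G θ F K x :=
  Finset.sum_eq_single K
    (fun L _ h => hS.frame_mul_matrixDeriv_diag_eq_zero hx (Ne.symm h)) (by simp)

theorem sum_baseConnection (K : ι) : ∑ L, baseConnection G θ F L x L K
    = (fibreConnection G θ F K x).trace + frameTrace G θ F K x := by
  simp_rw [hS.baseConnection_symm hx _ K]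
  change trace (baseConnection G θ F K x) = _
  rw [baseConnection, mul_add, trace_add, hS.trace_frame_mul_matrixDeriv hx, ← mul_assoc,
    trace_mul_comm, ← mul_assoc, hS.transpose_mul_frame hx, one_mul]

/-- The logarithmic derivative of `det G = (det F)² det H`, taken as a trace; the factors `F` and
`Fᵀ` each contribute one `frameTrace`. -/
theorem two_mul_trace_fibreConnection (K : ι) : 2 * (fibreConnection G θ F K x).trace
    = ∑ I, (G I x)⁻¹ * partialDeriv K (G I) x - 2 * frameTrace G θ F K x := by
  have hT := hS.smooth_F.transpose
  have hd : matrixDeriv K (fun z => diagonal fun I => G I z) x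
      = matrixDeriv K F x * fibreMetric G θ x * (F x)ᵀ
        + F x * matrixDeriv K (fibreMetric G θ) x * (F x)ᵀ
        + F x * fibreMetric G θ x * matrixDeriv K (fun z => (F z)ᵀ) x := by
    rw [matrixDeriv_congr hS.isOpen (N := fun z => F z * fibreMetric G θ z * (F z)ᵀ)
      (fun z hz => (hS.mul_fibreMetric_mul_transpose hz).symm) hx,
      matrixDeriv_mul hS.isOpen hx (hS.smooth_F.mul hS.smooth_fibreMetric) hT,
      matrixDeriv_mul hS.isOpen hx hS.smooth_F hS.smooth_fibreMetric, add_mul]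
  have hdiag : ((diagonal fun I => (G I x)⁻¹)
      * matrixDeriv K (fun z => diagonal fun I => G I z) x).trace
      = ∑ I, (G I x)⁻¹ * partialDeriv K (G I) x := by
    simp only [trace, diag_apply, diagonal_mul, matrixDeriv, of_apply, diagonal_apply_eq]
  have hHL := hS.fibreMetric_mul_transpose hx
  have hGR : (diagonal fun I => (G I x)⁻¹) * (F x * fibreMetric G θ x) = frameMatrix G θ x := by
    have h1 : F x * fibreMetric G θ x = θ x := by
      have := congrArg transpose hHL
      rwa [transpose_mul, transpose_transpose, transpose_transpose,
        hS.fibreMetric_isSymm hx] at this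
    rw [h1]
    ext I a
    simp [frameMatrix]
  have hGF : (F x)ᵀ * (diagonal fun I => (G I x)⁻¹) * F x = fibreMetricInv G F x := rfl
  have hq := hS.trace_frame_mul_matrixDeriv hx K
  have e3 : ((diagonal fun I => (G I x)⁻¹) * (F x * fibreMetric G θ x
      * matrixDeriv K (fun z => (F z)ᵀ) x)).trace = frameTrace G θ F K x := by
    rw [← mul_assoc, hGR, hq]
  have e2 : ((diagonal fun I => (G I x)⁻¹) * (F x * matrixDeriv K (fibreMetric G θ) x
      * (F x)ᵀ)).trace = 2 * (fibreConnection G θ F K x).trace := by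
    rw [← mul_assoc, trace_mul_comm, ← mul_assoc, ← mul_assoc, hGF, fibreConnection, trace_smul,
      smul_eq_mul]
    ring
  have e1 : ((diagonal fun I => (G I x)⁻¹) * (matrixDeriv K F x * fibreMetric G θ x
      * (F x)ᵀ)).trace = frameTrace G θ F K x := by
    rw [← e3, ← trace_transpose]
    simp only [transpose_mul, transpose_transpose, diagonal_transpose, hS.fibreMetric_isSymm hx]
    rw [trace_mul_comm, matrixDeriv_transpose]
    simp only [mul_assoc]
  rw [← hdiag, hd, mul_add, mul_add, trace_add, trace_add, e1, e2, e3]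
  ring

/-- Differentiate the `(I, L)` duality relation along `x_I`, and exchange `∂_I θ_L` for `∂_L θ_I` by
closedness. Row `I` of `F` does not depend on `x_L`, so the `(I, I)` relation evaluates the result.
-/
theorem frame_mul_matrixDeriv_of_ne {I L : ι} (h : L ≠ I) :
    (frameMatrix G θ x * matrixDeriv I (fun z => (F z)ᵀ) x) L I
      = -((G L x)⁻¹ * partialDeriv L (G I) x) := by
  have dF := fun J a => (hS.smooth_F J a).differentiableAt_of_mem hS.isOpen hx
  have dθ := fun J a => (hS.smooth_θ J a).differentiableAt_of_mem hS.isOpen hx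
  have h1 : ∑ a, (partialDeriv I (fun z => F z I a) x * θ x L a
      + F x I a * partialDeriv I (fun z => θ z L a) x) = 0 := by
    have := partialDeriv_congr hS.isOpen (f := fun z => ∑ a, F z I a * θ z L a) (g := fun _ => 0)
      (fun z hz => by simp [hS.duality z hz I L, Ne.symm h]) hx I
    rw [partialDeriv_const, partialDeriv_sum _ fun a _ => (dF I a).fun_mul (dθ L a)] at this
    rw [← this]
    exact Finset.sum_congr rfl fun a _ => (partialDeriv_mul (dF I a) (dθ L a) I).symm
  have h2 : ∑ a, F x I a * partialDeriv L (fun z => θ z I a) x = partialDeriv L (G I) x := by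
    rw [← partialDeriv_congr hS.isOpen (f := fun z => ∑ a, F z I a * θ z I a) (g := G I)
      (fun z hz => by simp [hS.duality z hz I I]) hx L,
      partialDeriv_sum _ fun a _ => (dF I a).fun_mul (dθ I a)]
    refine Finset.sum_congr rfl fun a _ => ?_
    rw [partialDeriv_mul (dF I a) (dθ I a), hS.separated x hx L I a h]
    ring
  simp_rw [hS.closed_θ x hx I L] at h1
  rw [Finset.sum_add_distrib, h2] at h1
  rw [mul_apply]
  simp only [frameMatrix, of_apply, matrixDeriv, transpose_apply, mul_assoc, ← Finset.mul_sum]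
  rw [← mul_neg, ← eq_neg_of_add_eq_zero_left h1]
  congr 1
  exact Finset.sum_congr rfl fun a _ => mul_comm _ _

omit hx
include hy

/-- The quadratic terms cancel. What remains is the Hessian of `-½ log det H` for the flat
connection in which the `du_a` are parallel. -/
theorem ricci_inl_inl_eq (J I : ι) :
    ricciCurvature (separableMetric G θ) (Sum.inl J) (Sum.inl I) y
      = -partialDeriv I (fun z => (fibreConnection G θ F J z).trace) (baseCoord y)
        + ∑ L, (fibreConnection G θ F L (baseCoord y)).trace
          * (frameMatrix G θ (baseCoord y)
            * matrixDeriv I (fun z => (F z)ᵀ) (baseCoord y)) L J := by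
  rw [hS.ricci_inl_inl hy]
  simp_rw [hS.baseConnection_curvature hy, mul_sub, sub_mul, Matrix.sub_apply]
  rw [Finset.sum_sub_distrib, hS.sum_frame_mul_fibreConnection hy,
    hS.sum_frame_mul_fibreConnection' hy]
  simp_rw [baseConnection, mul_add, Matrix.add_apply, mul_add, Finset.sum_add_distrib]
  ring

/-- Moving `H⁻¹` inside `∂_K` costs `2 G_K⁻¹ tr C_K²`, which the two quadratic terms of the Ricci
block cancel exactly. -/
theorem sum_inv_mul_ricci_inr_inr :
    ∑ c, ∑ b, fibreMetricInv G F (baseCoord y) c b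
        * ricciCurvature (separableMetric G θ) (Sum.inr c) (Sum.inr b) y
      = ∑ K, (-partialDeriv K (fun z => (G K z)⁻¹ * (fibreConnection G θ F K z).trace) (baseCoord y)
        - (G K (baseCoord y))⁻¹ * (fibreConnection G θ F K (baseCoord y)).trace
          * (2 * (fibreConnection G θ F K (baseCoord y)).trace
            + frameTrace G θ F K (baseCoord y))) := by
  simp_rw [hS.ricci_inr_inr hy, Finset.mul_sum]
  simp_rw [Finset.sum_comm (s := Finset.univ (α := ι)) (t := Finset.univ (α := ι))
    (f := fun b K => fibreMetricInv G F (baseCoord y) _ b * _)]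
  rw [Finset.sum_comm]
  refine Finset.sum_congr rfl fun K _ => ?_
  rw [hS.sum_baseConnection hy]
  set x := baseCoord y with hxdef
  set M : (ι → ℝ) → Matrix ι ι ℝ := fun z => Matrix.of fun b c =>
    -(1 / 2) * ((G K z)⁻¹ * matrixDeriv K (fibreMetric G θ) z b c) with hM
  have hMs : SmoothMatrixOn M U := fun b c => contDiffOn_const.mul ((hS.smooth_Ginv K).mul
    (hS.smooth_fibreMetric.matrixDeriv hS.isOpen K b c))
  have hMeq : ∀ z, M z = (-(1 / 2) * (G K z)⁻¹) • matrixDeriv K (fibreMetric G θ) z := by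
    intro z
    ext b c
    simp [hM, mul_assoc]
  have htr : ∀ z, (fibreMetricInv G F z * M z).trace
      = -((G K z)⁻¹ * (fibreConnection G θ F K z).trace) := by
    intro z
    rw [hMeq, mul_smul_comm, trace_smul, fibreConnection, trace_smul, smul_eq_mul, smul_eq_mul]
    ring
  have hsum : ∀ N : Matrix ι ι ℝ, ∑ c, ∑ b, fibreMetricInv G F x c b * N b c
      = (fibreMetricInv G F x * N).trace := fun N => by
    simp only [trace, diag_apply, mul_apply]
  have hdM : (fibreMetricInv G F x * matrixDeriv K M x).trace
      = -partialDeriv K (fun z => (G K z)⁻¹ * (fibreConnection G θ F K z).trace) x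
        - 2 * (G K x)⁻¹ * (fibreConnection G θ F K x * fibreConnection G θ F K x).trace := by
    have h1 := partialDeriv_trace hS.isOpen hy (hS.smooth_fibreMetricInv.mul hMs) K
    rw [matrixDeriv_mul hS.isOpen hy hS.smooth_fibreMetricInv hMs, trace_add] at h1
    simp_rw [htr] at h1
    rw [partialDeriv_neg, hS.matrixDeriv_fibreMetricInv hy] at h1
    have h2 : (-(2 : ℝ) • (fibreConnection G θ F K x * fibreMetricInv G F x) * M x).trace
        = 2 * (G K x)⁻¹ * (fibreConnection G θ F K x * fibreConnection G θ F K x).trace := by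
      rw [hMeq, smul_mul_assoc, mul_smul_comm, mul_assoc, trace_smul, trace_smul]
      conv_rhs => rw [fibreConnection, mul_smul_comm, trace_smul, ← fibreConnection]
      simp only [smul_eq_mul]
      ring
    rw [h2] at h1
    linarith
  have hCT : (fibreConnection G θ F K x)ᵀ
      = (1 / 2 : ℝ) • (matrixDeriv K (fibreMetric G θ) x * fibreMetricInv G F x) := by
    have hHT : (matrixDeriv K (fibreMetric G θ) x)ᵀ = matrixDeriv K (fibreMetric G θ) x :=
      (matrixDeriv_transpose K).symm.trans
        (matrixDeriv_congr hS.isOpen (fun z hz => hS.fibreMetric_isSymm hz) hy K)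
    rw [fibreConnection, transpose_smul, transpose_mul, hHT]
    simp [fibreMetricInv, transpose_mul, mul_assoc]
  have hD : matrixDeriv K (fibreMetric G θ) x
      = (2 : ℝ) • (fibreMetric G θ x * fibreConnection G θ F K x) :=
    hS.matrixDeriv_fibreMetric hy K
  have e1 : (fibreMetricInv G F x
      * (matrixDeriv K (fibreMetric G θ) x * fibreConnection G θ F K x)).trace
      = 2 * (fibreConnection G θ F K x * fibreConnection G θ F K x).trace := by
    rw [hD, smul_mul_assoc, mul_smul_comm, trace_smul, smul_eq_mul, ← mul_assoc, ← mul_assoc,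
      hS.inv_mul_fibreMetric hy, one_mul]
  have e2 : (fibreMetricInv G F x
      * ((fibreConnection G θ F K x)ᵀ * matrixDeriv K (fibreMetric G θ) x)).trace
      = 2 * (fibreConnection G θ F K x * fibreConnection G θ F K x).trace := by
    rw [← e1, hCT]
    conv_rhs => rw [fibreConnection]
    simp only [smul_mul_assoc, mul_smul_comm, mul_assoc]
  have e0 : (fibreMetricInv G F x * matrixDeriv K (fibreMetric G θ) x).trace
      = 2 * (fibreConnection G θ F K x).trace := by
    rw [fibreConnection, trace_smul, smul_eq_mul]; ring
  calc _ = ∑ c, ∑ b, (fibreMetricInv G F x c b * matrixDeriv K M x b c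
        - (1 / 2) * (G K x)⁻¹ * ((fibreConnection G θ F K x).trace + frameTrace G θ F K x
          + (fibreConnection G θ F K x).trace)
          * (fibreMetricInv G F x c b * matrixDeriv K (fibreMetric G θ) x b c)
        + (1 / 2) * (G K x)⁻¹ * (fibreMetricInv G F x c b * ((matrixDeriv K (fibreMetric G θ) x
              * fibreConnection G θ F K x) b c))
        + (1 / 2) * (G K x)⁻¹ * (fibreMetricInv G F x c b * (((fibreConnection G θ F K x)ᵀ
              * matrixDeriv K (fibreMetric G θ) x) b c))) := by
        refine Finset.sum_congr rfl fun c _ => Finset.sum_congr rfl fun b _ => ?_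
        rw [show matrixDeriv K M x b c = partialDeriv K (fun z => -(1 / 2) * ((G K z)⁻¹
          * matrixDeriv K (fibreMetric G θ) z b c)) x from rfl]
        ring
    _ = _ := by
        simp only [Finset.sum_add_distrib, Finset.sum_sub_distrib, ← Finset.mul_sum, hsum, hdM,
          e0, e1, e2]
        ring

/-- The scalar curvature of a separable toric Kähler metric. -/
theorem scalarCurvature_eq :
    scalarCurvature (separableMetric G θ) y
      = -∑ K, (G K (baseCoord y))⁻¹ *
        (partialDeriv K (fun z => 2 * (fibreConnection G θ F K z).trace) (baseCoord y)
          + 2 * (fibreConnection G θ F K (baseCoord y)).trace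
            * (2 * (fibreConnection G θ F K (baseCoord y)).trace
              + frameTrace G θ F K (baseCoord y)
              - (G K (baseCoord y))⁻¹ * partialDeriv K (G K) (baseCoord y))) := by
  have h0 : scalarCurvature (separableMetric G θ) y
      = ∑ I, (G I (baseCoord y))⁻¹
          * ricciCurvature (separableMetric G θ) (Sum.inl I) (Sum.inl I) y
        + ∑ c, ∑ b, fibreMetricInv G F (baseCoord y) c b
          * ricciCurvature (separableMetric G θ) (Sum.inr c) (Sum.inr b) y := by
    simp only [scalarCurvature, hS.separableMetric_inv hy, Fintype.sum_sum_type,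
      fromBlocks_apply₁₁, fromBlocks_apply₁₂, fromBlocks_apply₂₁, fromBlocks_apply₂₂,
      Matrix.zero_apply, zero_mul, Finset.sum_const_zero, add_zero, zero_add, diagonal_apply,
      ite_mul, Finset.sum_ite_eq, Finset.mem_univ, if_true]
  rw [h0, hS.sum_inv_mul_ricci_inr_inr hy]
  simp_rw [hS.ricci_inl_inl_eq hy, mul_add, Finset.sum_add_distrib, Finset.mul_sum]
  rw [Finset.sum_comm (f := fun I L => (G I (baseCoord y))⁻¹ * _), ← Finset.sum_add_distrib,
    ← Finset.sum_add_distrib, ← Finset.sum_add_distrib, ← Finset.sum_neg_distrib]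
  refine Finset.sum_congr rfl fun K _ => ?_
  have ht := hS.two_mul_trace_fibreConnection hy K
  set x := baseCoord y with hxdef
  have dt : DifferentiableAt ℝ (fun z => (fibreConnection G θ F K z).trace) x :=
    (hS.smooth_fibreConnection K).trace.differentiableAt_of_mem hS.isOpen hy
  have dG : DifferentiableAt ℝ (G K) x := (hS.smooth_G K).differentiableAt_of_mem hS.isOpen hy
  have dGi : DifferentiableAt ℝ (fun z => (G K z)⁻¹) x :=
    (hS.smooth_Ginv K).differentiableAt_of_mem hS.isOpen hy
  have hG0 := hS.G_ne_zero x hy K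
  -- The diagonal entry is `frameTrace`; the others are logarithmic derivatives of the `G_I` along
  -- `x_K`, whose full sum is known from `det G = (det F)² det H`.
  have hp : ∑ I, (G I x)⁻¹ * ((fibreConnection G θ F K x).trace
      * (frameMatrix G θ x * matrixDeriv I (fun z => (F z)ᵀ) x) K I)
      = (G K x)⁻¹ * (fibreConnection G θ F K x).trace * (frameTrace G θ F K x
        - (∑ I, (G I x)⁻¹ * partialDeriv K (G I) x - (G K x)⁻¹ * partialDeriv K (G K) x)) := by
    rw [← Finset.add_sum_erase _ _ (Finset.mem_univ K),
      ← Finset.add_sum_erase _ (fun I => (G I x)⁻¹ * partialDeriv K (G I) x) (Finset.mem_univ K),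
      add_sub_cancel_left, mul_sub, Finset.mul_sum, sub_eq_add_neg, ← Finset.sum_neg_distrib]
    congr 1
    · rw [frameTrace]; ring
    · refine Finset.sum_congr rfl fun I hI => ?_
      rw [hS.frame_mul_matrixDeriv_of_ne hy (Finset.ne_of_mem_erase hI).symm]
      ring
  rw [hp, partialDeriv_mul dGi dt, partialDeriv_inv dG hG0, partialDeriv_const_mul _ dt]
  rw [show ∑ I, (G I x)⁻¹ * partialDeriv K (G I) x
    = 2 * (fibreConnection G θ F K x).trace + 2 * frameTrace G θ F K x by rw [ht]; ring]
  field_simp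
  ring

end IsSeparableKahler

end SeparableScalar

/-! ### Invariant Killing potentials. -/

section SeparableKilling

open Matrix

/-- The complex structure of a separable toric Kähler metric, on tangent vectors. -/
def separableComplexStructure {ι : Type*} [DecidableEq ι] (G : ι → (ι → ℝ) → ℝ)
    (θ F : (ι → ℝ) → Matrix ι ι ℝ) (y : ι ⊕ ι → ℝ) : Matrix (ι ⊕ ι) (ι ⊕ ι) ℝ :=
  fromBlocks 0 (Matrix.of fun I a => -((G I (baseCoord y))⁻¹ * θ (baseCoord y) I a))
    (F (baseCoord y))ᵀ 0

/-- The components of the vector field `J grad φ` on the torus, for invariant `φ`. -/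
def rotatedGradient {ι : Type*} [Fintype ι] [DecidableEq ι] (G : ι → (ι → ℝ) → ℝ)
    (F : (ι → ℝ) → Matrix ι ι ℝ) (φ : (ι → ℝ) → ℝ) (a : ι) (x : ι → ℝ) : ℝ :=
  ∑ I, F x I a * ((G I x)⁻¹ * partialDeriv I φ x)

namespace IsSeparableKahler

variable {ι : Type*} [Fintype ι] [DecidableEq ι] {U : Set (ι → ℝ)} {G : ι → (ι → ℝ) → ℝ}
  {θ F : (ι → ℝ) → Matrix ι ι ℝ} (hS : IsSeparableKahler U G θ F) {y : ι ⊕ ι → ℝ}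
  {f : (ι ⊕ ι → ℝ) → ℝ} {φ : (ι → ℝ) → ℝ} (hφ : ContDiffOn ℝ ∞ φ U)
  (hf : ∀ z, baseCoord z ∈ U → f z = φ (baseCoord z))
include hS hφ

theorem smooth_rotatedGradient (a : ι) : ContDiffOn ℝ ∞ (rotatedGradient G F φ a) U :=
  ContDiffOn.sum fun I _ => (hS.smooth_F I a).mul
    ((hS.smooth_Ginv I).mul (hφ.partialDeriv hS.isOpen I))

include hf

theorem rotated_metricGradient_inl (hy : baseCoord y ∈ U) (I : ι) :
    (separableComplexStructure G θ F y).mulVec (metricGradient (separableMetric G θ) f y)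
      (Sum.inl I) = 0 := by
  simp [mulVec, dotProduct, separableComplexStructure, metricGradient, hS.separableMetric_inv hy,
    hS.partialDeriv_inr_of_eq hy hf]

theorem rotated_metricGradient_inr (hy : baseCoord y ∈ U) (a : ι) :
    (separableComplexStructure G θ F y).mulVec (metricGradient (separableMetric G θ) f y)
      (Sum.inr a) = rotatedGradient G F φ a (baseCoord y) := by
  simp [mulVec, dotProduct, separableComplexStructure, metricGradient, hS.separableMetric_inv hy,
    hS.partialDeriv_inl_of_eq hy hφ hf, rotatedGradient, diagonal_apply]

/-- The field `X = J grad f` is tangent to the torus orbits and invariant, so only the mixed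
components of `L_X g` can be non-zero. They are `H ∂_I X`, and `H` is invertible. -/
theorem isKillingPotentialOn_iff_rotatedGradient {Ω : Set (ι ⊕ ι → ℝ)} (hΩ : baseCoord '' Ω = U) :
    IsKillingPotentialOn (separableMetric G θ) (separableComplexStructure G θ F) f Ω ↔
      ∀ x ∈ U, ∀ I a, partialDeriv I (rotatedGradient G F φ a) x = 0 := by
  set X : (ι ⊕ ι → ℝ) → ι ⊕ ι → ℝ := fun y => (separableComplexStructure G θ F y).mulVec
    (metricGradient (separableMetric G θ) f y) with hX
  have hXl : ∀ {y}, baseCoord y ∈ U → ∀ I, X y (Sum.inl I) = 0 := fun hy I =>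
    hS.rotated_metricGradient_inl hφ hf hy I
  have hXr : ∀ {y}, baseCoord y ∈ U → ∀ a, X y (Sum.inr a) = rotatedGradient G F φ a (baseCoord y) :=
    fun hy a => hS.rotated_metricGradient_inr hφ hf hy a
  have d1 : ∀ {y}, baseCoord y ∈ U → ∀ I J, partialDeriv (Sum.inl I) (fun z => X z (Sum.inl J)) y
      = 0 := fun {y} hy I J => by
    rw [hS.partialDeriv_inl_of_eq hy (φ := fun _ => 0) contDiffOn_const (fun z hz => hXl hz J) I,
      partialDeriv_const]
  have d2 : ∀ {y}, baseCoord y ∈ U → ∀ a J, partialDeriv (Sum.inr a) (fun z => X z (Sum.inl J)) y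
      = 0 := fun {y} hy a J =>
    hS.partialDeriv_inr_of_eq hy (φ := fun _ => 0) (fun z hz => hXl hz J) a
  have d3 : ∀ {y}, baseCoord y ∈ U → ∀ I a, partialDeriv (Sum.inl I) (fun z => X z (Sum.inr a)) y
      = partialDeriv I (rotatedGradient G F φ a) (baseCoord y) := fun {y} hy I a =>
    hS.partialDeriv_inl_of_eq hy (hS.smooth_rotatedGradient hφ a) (fun z hz => hXr hz a) I
  have d4 : ∀ {y}, baseCoord y ∈ U → ∀ b a, partialDeriv (Sum.inr b) (fun z => X z (Sum.inr a)) y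
      = 0 := fun {y} hy b a => hS.partialDeriv_inr_of_eq hy (fun z hz => hXr hz a) b
  constructor
  · intro hK x hx I a
    obtain ⟨y, hy, rfl⟩ := hΩ.symm ▸ hx
    have hv : fibreMetric G θ (baseCoord y) *ᵥ
        (fun a => partialDeriv I (rotatedGradient G F φ a) (baseCoord y)) = 0 := by
      ext c
      have h := hK y hy (Sum.inr c) (Sum.inl I)
      change lieDerivMetric (separableMetric G θ) X _ _ y = 0 at h
      simpa [lieDerivMetric, Fintype.sum_sum_type, hXl hx, d1 hx, d2 hx, d3 hx, d4 hx,
        partialDeriv_inr_metric, partialDeriv_const, separableMetric, mulVec, dotProduct] using h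
    have h0 := congrArg (fun v => fibreMetricInv G F (baseCoord y) *ᵥ v) hv
    simp only [mulVec_mulVec, hS.inv_mul_fibreMetric hx, one_mulVec, mulVec_zero] at h0
    exact congrFun h0 a
  · intro h y hy p q
    have hx : baseCoord y ∈ U := hΩ ▸ Set.mem_image_of_mem _ hy
    change lieDerivMetric (separableMetric G θ) X _ _ y = 0
    have hd : ∀ p c, partialDeriv p (fun z => X z c) y = 0 := by
      rintro (I | b) (J | a)
      · exact d1 hx I J
      · rw [d3 hx, h _ hx]
      · exact d2 hx b J
      · exact d4 hx b a
    have hg : ∀ a, partialDeriv (Sum.inr a) (fun z => separableMetric G θ z p q) y = 0 :=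
      fun a => partialDeriv_inr_metric a p q
    simp [lieDerivMetric, Fintype.sum_sum_type, hXl hx, hd, hg]

/-- Invariant Killing potentials are affine functions of the momenta. -/
theorem isKillingPotentialOn_iff {Ω : Set (ι ⊕ ι → ℝ)} (hΩ : baseCoord '' Ω = U)
    (hU : IsPreconnected U) :
    IsKillingPotentialOn (separableMetric G θ) (separableComplexStructure G θ F) f Ω ↔
      ∃ c : ι → ℝ, ∀ x ∈ U, ∀ I, partialDeriv I φ x = ∑ a, c a * θ x I a := by
  rw [hS.isKillingPotentialOn_iff_rotatedGradient hφ hf hΩ]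
  -- By duality, the components of `J grad φ` are the coefficients of `dφ` in the forms given by the
  -- columns of `θ`.
  have hk : ∀ x ∈ U, ∀ J, partialDeriv J φ x = ∑ a, rotatedGradient G F φ a x * θ x J a := by
    intro x hx J
    simp_rw [rotatedGradient, Finset.sum_mul]
    rw [Finset.sum_comm]
    have : ∀ I, ∑ a, F x I a * ((G I x)⁻¹ * partialDeriv I φ x) * θ x J a
        = (if I = J then G I x else 0) * ((G I x)⁻¹ * partialDeriv I φ x) := fun I => by
      rw [← hS.duality x hx I J, Finset.sum_mul]
      exact Finset.sum_congr rfl fun a _ => by ring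
    simp_rw [this]
    simp [hS.G_ne_zero x hx J]
  constructor
  · intro h
    have hc := fun a => eqOn_const_of_partialDeriv_eq_zero (hS.smooth_rotatedGradient hφ a)
      hS.isOpen hU (fun x hx I => h x hx I a)
    choose c hc using hc
    refine ⟨c, fun x hx I => ?_⟩
    rw [hk x hx]
    simp_rw [hc _ x hx]
  · rintro ⟨c, hc⟩ x hx I a
    have : ∀ z ∈ U, rotatedGradient G F φ a z = c a := by
      intro z hz
      have h1 := congrFun (congrArg (fun M => M *ᵥ c) (hS.transpose_mul_frame hz)) a
      rw [one_mulVec] at h1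
      rw [← h1]
      simp only [← mulVec_mulVec]
      simp only [rotatedGradient, mulVec, dotProduct, hc z hz, transpose_apply, frameMatrix,
        of_apply, Finset.mul_sum]
      exact Finset.sum_congr rfl fun I _ => Finset.sum_congr rfl fun a _ => by ring
    rw [partialDeriv_congr hS.isOpen this hx, partialDeriv_const]

end IsSeparableKahler

end SeparableKilling

/-! ### The functions of a Segre–Veronese factorization structure -/

/-- The factors `M i` carry no topology, so smoothness comes from expanding over subsets of slots
into a polynomial in the `c i`. -/
theorem MultilinearMap.contDiff_apply_add_smul {κ E : Type*} [Fintype κ] [DecidableEq κ]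
    [NormedAddCommGroup E] [NormedSpace ℝ E] {M : κ → Type*} [∀ i, AddCommGroup (M i)]
    [∀ i, Module ℝ (M i)] (f : MultilinearMap ℝ M ℝ) (u v : ∀ i, M i) {c : κ → E → ℝ}
    (hc : ∀ i, ContDiff ℝ ∞ (c i)) : ContDiff ℝ ∞ fun x => f fun i => u i + c i x • v i := by
  have h : (fun x => f fun i => u i + c i x • v i)
      = fun x => ∑ s : Finset κ, (∏ i ∈ sᶜ, c i x) * f (s.piecewise u v) := by
    funext x
    have h1 := f.map_add_univ u fun i => c i x • v i
    rw [show (fun i => u i + c i x • v i) = u + fun i => c i x • v i from rfl, h1]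
    refine Finset.sum_congr rfl fun s _ => ?_
    rw [← smul_eq_mul, ← f.map_piecewise_smul]
    congr 1
    ext i
    by_cases hi : i ∈ s <;> simp [hi]
  rw [h]
  exact ContDiff.sum fun s _ => (contDiff_prod fun i _ => hc i).mul contDiff_const

/-! ### Logarithmic partial derivatives. -/

section LogPartial

variable {n : Type*} [Fintype n] [DecidableEq n] {x : n → ℝ}

/-- The logarithmic partial derivative. -/
def logPartial (a : n) (f : (n → ℝ) → ℝ) (x : n → ℝ) : ℝ :=
  (f x)⁻¹ * partialDeriv a f x

theorem logPartial_mul {f g : (n → ℝ) → ℝ} (hf : DifferentiableAt ℝ f x)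
    (hg : DifferentiableAt ℝ g x) (hf0 : f x ≠ 0) (hg0 : g x ≠ 0) (a : n) :
    logPartial a (fun z => f z * g z) x = logPartial a f x + logPartial a g x := by
  simp only [logPartial, partialDeriv_mul hf hg]
  field_simp

theorem logPartial_inv {f : (n → ℝ) → ℝ} (hf : DifferentiableAt ℝ f x) (hf0 : f x ≠ 0) (a : n) :
    logPartial a (fun z => (f z)⁻¹) x = -logPartial a f x := by
  simp only [logPartial, partialDeriv_inv hf hf0]
  field_simp

theorem logPartial_prod {ι : Type*} [DecidableEq ι] (s : Finset ι) {f : ι → (n → ℝ) → ℝ}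
    (hf : ∀ i ∈ s, DifferentiableAt ℝ (f i) x) (hf0 : ∀ i ∈ s, f i x ≠ 0) (a : n) :
    logPartial a (fun z => ∏ i ∈ s, f i z) x = ∑ i ∈ s, logPartial a (f i) x := by
  induction s using Finset.induction_on with
  | empty => simp [logPartial, partialDeriv_const]
  | insert i s hi ih =>
    simp only [Finset.prod_insert hi, Finset.sum_insert hi]
    have hs : DifferentiableAt ℝ (fun z => ∏ i ∈ s, f i z) x :=
      (HasFDerivAt.finsetProd fun j hj =>
        (hf j (Finset.mem_insert_of_mem hj)).hasFDerivAt).differentiableAt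
    rw [logPartial_mul (hf i (Finset.mem_insert_self i s)) hs
      (hf0 i (Finset.mem_insert_self i s))
      (Finset.prod_ne_zero_iff.mpr fun j hj => hf0 j (Finset.mem_insert_of_mem hj)),
      ih (fun j hj => hf j (Finset.mem_insert_of_mem hj))
        (fun j hj => hf0 j (Finset.mem_insert_of_mem hj))]

theorem logPartial_pow {f : (n → ℝ) → ℝ} (hf : DifferentiableAt ℝ f x) (hf0 : f x ≠ 0) (a : n)
    (N : ℕ) : logPartial a (fun z => f z ^ N) x = N * logPartial a f x := by
  have := logPartial_prod (Finset.range N) (f := fun _ => f) (fun _ _ => hf) (fun _ _ => hf0) a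
  simpa using this

theorem partialDeriv_eq_of_affine {f : (n → ℝ) → ℝ} (hf : DifferentiableAt ℝ f x) {a : n} {D : ℝ}
    (h : ∀ t : ℝ, f (x + t • Pi.single a (1 : ℝ)) = f x + t * D) : partialDeriv a f x = D := by
  unfold partialDeriv
  rw [← hf.lineDeriv_eq_fderiv, lineDeriv]
  simp [h]

end LogPartial

/-! ### Pairings, the factorization curve and Vandermonde factors. -/

namespace SegreVeronese

variable {k : ℕ} {d : Fin k → ℕ} {W : Fin k → Type*} [∀ i, AddCommGroup (W i)]
  [∀ i, Module ℝ (W i)] (S : SegreVeronese d W) (e : ∀ i, Module.Basis (Fin 2) ℝ (W i))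

theorem contDiff_pairing (h : S.space) : ContDiff ℝ ∞ (S.pairing e h) :=
  (h : TensorSpace d W).contDiff_apply_add_smul (fun I => e I.1 0) (fun I => e I.1 1)
    (c := fun I (x : Slot d → ℝ) => x I) fun I => contDiff_apply ℝ ℝ I

theorem contDiff_pairingOff (i : Fin k) : ContDiff ℝ ∞ (S.pairingOff e i) :=
  (S.Γ i).contDiff_apply_add_smul (fun I => e I.1.1 0) (fun I => e I.1.1 1)
    (c := fun I (x : Slot d → ℝ) => x I.1) fun I => contDiff_apply ℝ ℝ I.1

theorem contDiff_pairingProd : ContDiff ℝ ∞ (S.pairingProd e) :=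
  contDiff_prod fun p _ => (S.contDiff_pairingOff e p).pow _

theorem contDiff_vandermonde (I : Slot d) : ContDiff ℝ ∞ (S.vandermonde I) :=
  contDiff_prod fun _ _ => (contDiff_apply ℝ ℝ I).sub (contDiff_apply ℝ ℝ _)

theorem contDiff_curve (φ : S.space →ₗ[ℝ] ℝ) (i : Fin k) :
    ContDiff ℝ ∞ fun t => φ (S.curve e i t) := by
  -- The multilinear expansion in `annForm` leaves `𝔥`, since mixed products of linear forms need
  -- not be symmetric; hence the extension to all tensors.
  obtain ⟨ψ, hψ⟩ := φ.exists_extend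
  let f : MultilinearMap ℝ (fun _ : Fin (d i) => W i →ₗ[ℝ] ℝ) ℝ :=
    (ψ ∘ₗ insTensor i (S.Γ i)).compMultilinearMap
      (MultilinearMap.piLinearMap (MultilinearMap.mkPiAlgebra ℝ (Fin (d i)) ℝ))
  have h : (fun t => φ (S.curve e i t))
      = fun t => f fun _ => -(e i).coord 1 + t • (e i).coord 0 := by
    funext t
    have h1 : ∀ t, (fun _ : Fin (d i) => -(e i).coord 1 + t • (e i).coord 0)
        = fun _ => S.annForm e i t := fun t => by
      funext _
      rw [annForm]
      abel
    rw [h1, ← hψ]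
    rfl
  rw [h]
  exact f.contDiff_apply_add_smul _ _ fun _ => contDiff_id

theorem point_add_single (x : Slot d → ℝ) (K : Slot d) (t : ℝ) :
    S.point e (x + t • Pi.single K (1 : ℝ))
      = Function.update (S.point e x) K (S.point e x K + t • e K.1 1) := by
  funext I
  by_cases h : I = K
  · subst h
    simp [point, add_smul, add_assoc]
  · simp [point, h]

theorem pairing_add_single (h : S.space) (x : Slot d → ℝ) (K : Slot d) (t : ℝ) :
    S.pairing e h (x + t • Pi.single K (1 : ℝ)) = S.pairing e h x
      + t * (h : TensorSpace d W) (Function.update (S.point e x) K (e K.1 1)) := by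
  rw [pairing, point_add_single, MultilinearMap.map_update_add, MultilinearMap.map_update_smul,
    Function.update_eq_self, smul_eq_mul, pairing]

theorem partialDeriv_pairing (h : S.space) (x : Slot d → ℝ) (K : Slot d) :
    partialDeriv K (S.pairing e h) x
      = (h : TensorSpace d W) (Function.update (S.point e x) K (e K.1 1)) :=
  partialDeriv_eq_of_affine (((S.contDiff_pairing e h).differentiable (by simp)) x)
    fun t => S.pairing_add_single e h x K t

/-- Each coordinate enters through one slot, so `⟨μ, h⟩` is affine in it. This is what later gives
`∂_K² log ⟨μ, β⟩ = -(∂_K log ⟨μ, β⟩)²`. -/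
theorem partialDeriv_partialDeriv_pairing (h : S.space) (x : Slot d → ℝ) (K : Slot d) :
    partialDeriv K (partialDeriv K (S.pairing e h)) x = 0 :=
  partialDeriv_eq_zero_of_forall (fun z t => by
    rw [partialDeriv_pairing, partialDeriv_pairing, point_add_single, Function.update_idem]) x

theorem pairingOff_add_single (x : Slot d → ℝ) (K : Slot d) (t : ℝ) :
    S.pairingOff e K.1 (x + t • Pi.single K (1 : ℝ)) = S.pairingOff e K.1 x := by
  rw [pairingOff, pairingOff]
  congr 1
  funext I
  have : I.1 ≠ K := fun h => I.2 (by rw [h])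
  simp [point, this]

theorem pairing_curve (i : Fin k) (t : ℝ) (x : Slot d → ℝ) :
    S.pairing e (S.curve e i t) x = (∏ s, (t - x ⟨i, s⟩)) * S.pairingOff e i x := by
  change (∏ s, S.annForm e i t (S.point e x ⟨i, s⟩)) * S.pairingOff e i x = _
  congr 1
  refine Finset.prod_congr rfl fun s _ => ?_
  simp [annForm, point]

/-- The pairing `⟨μ, h⟩` as a linear function of `h`. -/
def pairingₗ (x : Slot d → ℝ) : S.space →ₗ[ℝ] ℝ where
  toFun h := S.pairing e h x
  map_add' _ _ := rfl
  map_smul' _ _ := rfl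

/-- Each difference involving `x_K` occurs twice up to sign in the product of all Vandermonde
factors: once in that of `K`, once in that of the other slot. The proof encodes this by the
antisymmetry of `1 / (x_r - x_s)`. -/
theorem sum_logPartial_vandermonde {x : Slot d → ℝ} (hx : ∀ I, S.vandermonde I x ≠ 0)
    (K : Slot d) :
    ∑ I, logPartial K (S.vandermonde I) x = 2 * logPartial K (S.vandermonde K) x := by
  have hne : ∀ (i : Fin k) (r s : Fin (d i)), r ≠ s → x ⟨i, r⟩ - x ⟨i, s⟩ ≠ 0 := fun i r s h =>
    Finset.prod_ne_zero_iff.mp (hx ⟨i, r⟩) s (Finset.mem_erase.mpr ⟨h.symm, Finset.mem_univ _⟩)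
  let a : ∀ i : Fin k, Fin (d i) → Fin (d i) → ℝ := fun i r s => (x ⟨i, r⟩ - x ⟨i, s⟩)⁻¹
  let δ : Slot d → ℝ := fun I => if I = K then 1 else 0
  have hanti : ∀ i r s, a i r s = -a i s r := fun i r s => by
    simp only [a]
    rw [← neg_sub, inv_neg]
  have hlog : ∀ i r, logPartial K (S.vandermonde ⟨i, r⟩) x
      = ∑ s, (δ ⟨i, r⟩ - δ ⟨i, s⟩) * a i r s := by
    intro i r
    have hd : ∀ I : Slot d, DifferentiableAt ℝ (fun z : Slot d → ℝ => z I) x := fun I =>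
      differentiableAt_apply I x
    have h := logPartial_prod (x := x) (Finset.univ.erase r)
      (f := fun s z => z (⟨i, r⟩ : Slot d) - z ⟨i, s⟩)
      (fun s _ => (hd _).fun_sub (hd _))
      (fun s hs => hne i r s (Finset.ne_of_mem_erase hs).symm) K
    change logPartial K (fun z => ∏ s ∈ Finset.univ.erase r, (z (⟨i, r⟩ : Slot d) - z ⟨i, s⟩)) x = _
    rw [h, ← Finset.add_sum_erase _ _ (Finset.mem_univ r), sub_self, zero_mul, zero_add]
    refine Finset.sum_congr rfl fun s _ => ?_
    rw [logPartial, partialDeriv_sub (hd _) (hd _), partialDeriv_apply, partialDeriv_apply, mul_comm]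
  have hK : logPartial K (S.vandermonde K) x = ∑ s, a K.1 K.2 s := by
    rw [hlog K.1 K.2]
    refine Finset.sum_congr rfl fun s _ => ?_
    by_cases h : s = K.2
    · subst h
      simp [a]
    · have : (⟨K.1, s⟩ : Slot d) ≠ K := fun h' => h (by
        obtain ⟨i, r⟩ := K
        simpa using h')
      simp [δ, this]
  have hδ : ∑ I : Slot d, δ I * ∑ s, a I.1 I.2 s = ∑ s, a K.1 K.2 s := by
    simp [δ]
  rw [hK, ← hδ, Fintype.sum_sigma, Fintype.sum_sigma, Finset.mul_sum]
  refine Finset.sum_congr rfl fun i _ => ?_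
  have hswap : ∑ r, ∑ s, δ ⟨i, s⟩ * a i r s = -∑ r, ∑ s, δ ⟨i, r⟩ * a i r s := by
    rw [Finset.sum_comm, ← Finset.sum_neg_distrib]
    refine Finset.sum_congr rfl fun s _ => ?_
    rw [← Finset.sum_neg_distrib]
    refine Finset.sum_congr rfl fun r _ => ?_
    rw [hanti i r s, mul_neg]
  simp only [hlog, sub_mul, Finset.sum_sub_distrib, hswap, Finset.mul_sum, sub_neg_eq_add, ← two_mul]

end SegreVeronese

/-! ### The separable Kähler geometry of a factorization structure -/

namespace SegreVeronese

open Matrix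

variable {k : ℕ} {d : Fin k → ℕ} {W : Fin k → Type*} [∀ i, AddCommGroup (W i)]
  [∀ i, Module ℝ (W i)] (S : SegreVeronese d W) (e : ∀ i, Module.Basis (Fin 2) ℝ (W i))
  (A : Slot d → ℝ → ℝ) (β : S.space) (b : Module.Basis (Option (Slot d)) ℝ S.space)

/-- The matrix of the forms `⟨∂_I μ_β, dt⟩`. -/
def thetaMatrix (x : Slot d → ℝ) : Matrix (Slot d) (Slot d) ℝ :=
  Matrix.of fun I a => S.thetaCoeff e β b I a x

/-- The matrix of the holomorphic differentials, with rows `-(ψ_I(x_I) mod β) / A_I(x_I)`. -/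
def holoMatrix (x : Slot d → ℝ) : Matrix (Slot d) (Slot d) ℝ :=
  Matrix.of fun I a => -(b.repr (S.curve e I.1 (x I)) (some a) / A I (x I))

theorem metric_eq_separableMetric :
    S.metric e A β b = separableMetric (S.metricCoeff e A β) (S.thetaMatrix e β b) := rfl

theorem complexStructure_eq_separable : S.complexStructure e A β b
    = separableComplexStructure (S.metricCoeff e A β) (S.thetaMatrix e β b)
        (S.holoMatrix e A b) := rfl

/-- An open set of base points on which the separable Kähler geometry is defined. -/
structure IsAdmissible (U : Set (Slot d → ℝ)) : Prop where
  isOpen : IsOpen U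
  smooth_A : ∀ I, ContDiffOn ℝ ∞ (fun x => A I (x I)) U
  A_ne_zero : ∀ x ∈ U, ∀ I, A I (x I) ≠ 0
  pairing_ne_zero : ∀ x ∈ U, S.pairing e β x ≠ 0
  metricCoeff_ne_zero : ∀ x ∈ U, ∀ I, S.metricCoeff e A β I x ≠ 0

namespace IsAdmissible

variable {S e A β b} {U : Set (Slot d → ℝ)} (hU : S.IsAdmissible e A β U) (hb : b none = β)
  {x : Slot d → ℝ} (hx : x ∈ U)

include hU

theorem vandermonde_ne_zero (hx : x ∈ U) (I : Slot d) : S.vandermonde I x ≠ 0 := fun h =>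
  hU.metricCoeff_ne_zero x hx I (by simp [metricCoeff, h])

theorem pairingOff_ne_zero (hx : x ∈ U) (I : Slot d) : S.pairingOff e I.1 x ≠ 0 := fun h =>
  hU.metricCoeff_ne_zero x hx I (by simp [metricCoeff, h])

theorem smooth_momentum (h : S.space) : ContDiffOn ℝ ∞ (S.momentum e β h) U :=
  (S.contDiff_pairing e h).contDiffOn.div (S.contDiff_pairing e β).contDiffOn hU.pairing_ne_zero

theorem smooth_metricCoeff (I : Slot d) : ContDiffOn ℝ ∞ (S.metricCoeff e A β I) U :=
  ((S.contDiff_vandermonde I).mul (S.contDiff_pairingOff e I.1)).contDiffOn.div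
    ((hU.smooth_A I).mul (S.contDiff_pairing e β).contDiffOn)
    fun z hz => mul_ne_zero (hU.A_ne_zero z hz I) (hU.pairing_ne_zero z hz)

include hb

/-- Since `⟨μ_β, β⟩ = 1`, the `β`-component of `h` contributes a constant, so derivatives see only
`h mod β`. -/
theorem momentum_eq_sum (h : S.space) (hx : x ∈ U) : S.momentum e β h x
    = b.repr h none + ∑ a, b.repr h (some a) * S.momentum e β (b (some a)) x := by
  have h1 : S.pairing e h x = ∑ o, b.repr h o * S.pairing e (b o) x := by
    change S.pairingₗ e x h = ∑ o, b.repr h o * S.pairingₗ e x (b o)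
    conv_lhs => rw [← b.sum_repr h, map_sum]
    simp
  have h0 := hU.pairing_ne_zero x hx
  rw [momentum, h1, Fintype.sum_option, hb, add_div, mul_div_cancel_right₀ _ h0, Finset.sum_div]
  simp only [momentum, mul_div_assoc]

theorem partialDeriv_momentum (h : S.space) (hx : x ∈ U) (J : Slot d) :
    partialDeriv J (S.momentum e β h) x = ∑ a, b.repr h (some a) * S.thetaMatrix e β b x J a := by
  have hd := fun a => (hU.smooth_momentum (b (some a))).differentiableAt_of_mem hU.isOpen hx
  rw [partialDeriv_congr hU.isOpen (fun z hz => hU.momentum_eq_sum hb h hz) hx,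
    partialDeriv_add (differentiableAt_const _)
      (DifferentiableAt.fun_sum fun a _ => (hd a).const_mul _),
    partialDeriv_const, zero_add, partialDeriv_sum _ fun a _ => (hd a).const_mul _]
  exact Finset.sum_congr rfl fun a _ => partialDeriv_const_mul _ (hd a) J

theorem partialDeriv_partialDeriv_momentum (h : S.space) (hx : x ∈ U) (J K : Slot d) :
    partialDeriv K (partialDeriv J (S.momentum e β h)) x
      = ∑ a, b.repr h (some a) * partialDeriv K (fun z => S.thetaMatrix e β b z J a) x := by
  have hd : ∀ a, DifferentiableAt ℝ (fun z => S.thetaMatrix e β b z J a) x := fun a =>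
    ((hU.smooth_momentum (b (some a))).partialDeriv hU.isOpen J).differentiableAt_of_mem
      hU.isOpen hx
  rw [partialDeriv_congr hU.isOpen (fun z hz => hU.partialDeriv_momentum hb h hz J) hx,
    partialDeriv_sum _ fun a _ => (hd a).const_mul _]
  exact Finset.sum_congr rfl fun a _ => partialDeriv_const_mul _ (hd a) K

omit hU hb in
theorem _root_.SegreVeronese.momentum_curve (I : Slot d) (t : ℝ) (z : Slot d → ℝ) :
    S.momentum e β (S.curve e I.1 t) z = (t - z I) *
      (((∏ s ∈ Finset.univ.erase I.2, (t - z ⟨I.1, s⟩)) * S.pairingOff e I.1 z)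
        * (S.pairing e β z)⁻¹) := by
  rw [momentum, pairing_curve, ← Finset.mul_prod_erase _ _ (Finset.mem_univ I.2)]
  simp only [Sigma.eta]
  ring

omit hU hb in
theorem _root_.SegreVeronese.contDiff_momentum_numerator (I : Slot d) (t : ℝ) :
    ContDiff ℝ ∞ fun z => (∏ s ∈ Finset.univ.erase I.2, (t - z ⟨I.1, s⟩))
      * S.pairingOff e I.1 z :=
  (contDiff_prod fun s _ => contDiff_const.sub (contDiff_apply ℝ ℝ (⟨I.1, s⟩ : Slot d))).mul
    (S.contDiff_pairingOff e I.1)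

omit hb in
-- The parameter `t` is frozen during differentiation and later set to `x_I`, where the second
-- summand vanishes.
theorem partialDeriv_momentum_curve (I J : Slot d) (t : ℝ) (hx : x ∈ U) :
    partialDeriv J (S.momentum e β (S.curve e I.1 t)) x = -(if I = J then 1 else 0) *
      (((∏ s ∈ Finset.univ.erase I.2, (t - x ⟨I.1, s⟩)) * S.pairingOff e I.1 x)
        * (S.pairing e β x)⁻¹)
      + (t - x I) * partialDeriv J (fun z =>
        ((∏ s ∈ Finset.univ.erase I.2, (t - z ⟨I.1, s⟩)) * S.pairingOff e I.1 z)
        * (S.pairing e β z)⁻¹) x := by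
  have hR : DifferentiableAt ℝ (fun z =>
        ((∏ s ∈ Finset.univ.erase I.2, (t - z ⟨I.1, s⟩)) * S.pairingOff e I.1 z)
        * (S.pairing e β z)⁻¹) x :=
    ((S.contDiff_momentum_numerator (e := e) I t).contDiffOn.mul
      ((S.contDiff_pairing e β).contDiffOn.inv hU.pairing_ne_zero)).differentiableAt_of_mem
      hU.isOpen hx
  have hl : DifferentiableAt ℝ (fun z : Slot d → ℝ => z I) x := differentiableAt_apply I x
  rw [show S.momentum e β (S.curve e I.1 t) = _ from funext fun z => momentum_curve I t z,
    partialDeriv_mul (hl.const_sub t) hR, partialDeriv_sub (differentiableAt_const t) hl,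
    partialDeriv_const, partialDeriv_apply, zero_sub]

omit hb in
theorem vandermonde_mul_pairingOff (hx : x ∈ U) (I : Slot d) :
    S.vandermonde I x * S.pairingOff e I.1 x * (S.pairing e β x)⁻¹
      = A I (x I) * S.metricCoeff e A β I x := by
  have h1 := hU.A_ne_zero x hx I
  have h2 := hU.pairing_ne_zero x hx
  rw [metricCoeff]
  field_simp

/-- Duality is the derivative of `⟨μ_β, ψ_I(t)⟩` at `t = x_I`; closedness is the symmetry of second
derivatives of the momenta; separation holds because `ψ_I / A_I` is a function of `x_I` alone. -/
theorem isSeparableKahler : IsSeparableKahler U (S.metricCoeff e A β) (S.thetaMatrix e β b)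
    (S.holoMatrix e A b) where
  isOpen := hU.isOpen
  smooth_G := hU.smooth_metricCoeff
  smooth_θ I a := (hU.smooth_momentum _).partialDeriv hU.isOpen I
  smooth_F I a := (((S.contDiff_curve e (b.coord (some a)) I.1).comp
    (contDiff_apply ℝ ℝ I)).contDiffOn.div (hU.smooth_A I)
      fun z hz => hU.A_ne_zero z hz I).neg
  G_ne_zero := hU.metricCoeff_ne_zero
  duality x hx I J := by
    have h := hU.partialDeriv_momentum hb (S.curve e I.1 (x I)) hx J
    rw [hU.partialDeriv_momentum_curve I J (x I) hx, sub_self, zero_mul, add_zero] at h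
    have h' := hU.vandermonde_mul_pairingOff hx I
    rw [vandermonde] at h'
    rw [h'] at h
    have hA := hU.A_ne_zero x hx I
    have e1 : ∑ a, S.holoMatrix e A b x I a * S.thetaMatrix e β b x J a
        = -(A I (x I))⁻¹ * ∑ a, b.repr (S.curve e I.1 (x I)) (some a)
          * S.thetaMatrix e β b x J a := by
      rw [Finset.mul_sum]
      refine Finset.sum_congr rfl fun a _ => ?_
      rw [holoMatrix, of_apply]
      ring
    rw [e1, ← h]
    split_ifs
    · field_simp
    · simp
  closed_θ x hx I J a := partialDeriv_comm (hU.smooth_momentum _) hU.isOpen hx I J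
  separated x hx I J a hIJ := partialDeriv_comp_apply_of_ne hIJ.symm
    (fun t => -(b.repr (S.curve e J.1 t) (some a) / A J t)) x

/-- Differentiating the duality `∑ F_{Ka} θ_{Ka} = G_K` along `x_K` trades the derivative of `F` for
that of `θ`, which is a second derivative of `⟨μ_β, ψ_K(t)⟩` with `t` frozen. -/
theorem frameTrace_eq (hx : x ∈ U) (K : Slot d) :
    frameTrace (S.metricCoeff e A β) (S.thetaMatrix e β b) (S.holoMatrix e A b) K x
      = logPartial K (S.metricCoeff e A β K) x + 2 * logPartial K (S.pairing e β) x := by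
  have hS := hU.isSeparableKahler hb
  have hA := hU.A_ne_zero x hx K
  have hw := hU.pairing_ne_zero x hx
  have hG := hU.metricCoeff_ne_zero x hx K
  have dF := fun a => (hS.smooth_F K a).differentiableAt_of_mem hU.isOpen hx
  have dθ := fun a => (hS.smooth_θ K a).differentiableAt_of_mem hU.isOpen hx
  set c : (Slot d → ℝ) → ℝ := fun z =>
    (∏ s ∈ Finset.univ.erase K.2, (x K - z ⟨K.1, s⟩)) * S.pairingOff e K.1 z with hc
  have hcs : ContDiff ℝ ∞ c := S.contDiff_momentum_numerator K (x K)
  have dw : DifferentiableAt ℝ (S.pairing e β) x :=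
    (S.contDiff_pairing e β).contDiffOn.differentiableAt_of_mem hU.isOpen hx
  have dc : DifferentiableAt ℝ c x := hcs.contDiffOn.differentiableAt_of_mem hU.isOpen hx
  have hRs : ContDiffOn ℝ ∞ (fun z => c z * (S.pairing e β z)⁻¹) U :=
    hcs.contDiffOn.mul ((S.contDiff_pairing e β).contDiffOn.inv hU.pairing_ne_zero)
  have dR := hRs.differentiableAt_of_mem hU.isOpen hx
  have dw' : DifferentiableAt ℝ (fun z => (S.pairing e β z)⁻¹) x := dw.fun_inv hw
  -- With `t` frozen at `x K`, the only factor involving `z K` has been split off, so `c` does not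
  -- depend on it.
  have hc0 : partialDeriv K c x = 0 := partialDeriv_eq_zero_of_forall (fun z t => by
    simp only [hc, pairingOff_add_single]
    congr 1
    refine Finset.prod_congr rfl fun s hs => ?_
    have : (⟨K.1, s⟩ : Slot d) ≠ K := fun h' => Finset.ne_of_mem_erase hs (by
      obtain ⟨i, r⟩ := K
      simpa using h')
    simp [this]) x
  have hcx : c x = A K (x K) * S.metricCoeff e A β K x * S.pairing e β x := by
    rw [← hU.vandermonde_mul_pairingOff hx K, vandermonde]
    field_simp
    simp [hc]
  have hRd : partialDeriv K (fun z => c z * (S.pairing e β z)⁻¹) x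
      = -(A K (x K) * S.metricCoeff e A β K x) * logPartial K (S.pairing e β) x := by
    rw [partialDeriv_mul dc dw', hc0, partialDeriv_inv dw hw, hcx, logPartial]
    field_simp
    ring
  -- For `R = c / ⟨μ, β⟩`, the second derivative of `(t - z_K) R` at `z_K = t` is `-2 ∂_K R`.
  have h2 : ∑ a, b.repr (S.curve e K.1 (x K)) (some a)
        * partialDeriv K (fun z => S.thetaMatrix e β b z K a) x
      = 2 * (A K (x K) * S.metricCoeff e A β K x) * logPartial K (S.pairing e β) x := by
    have dl : DifferentiableAt ℝ (fun z : Slot d → ℝ => z K) x := differentiableAt_apply K x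
    have dR' := (hRs.partialDeriv hU.isOpen K).differentiableAt_of_mem hU.isOpen hx
    rw [← hU.partialDeriv_partialDeriv_momentum hb _ hx,
      partialDeriv_congr hU.isOpen
        (fun z hz => hU.partialDeriv_momentum_curve K K (x K) hz) hx,
      partialDeriv_add (dR.const_mul _) ((dl.const_sub _).fun_mul dR'),
      partialDeriv_const_mul _ dR, partialDeriv_mul (dl.const_sub _) dR',
      partialDeriv_sub (differentiableAt_const _) dl, partialDeriv_const, partialDeriv_apply, hRd]
    simp
    ring
  have h3 : ∑ a, S.holoMatrix e A b x K a * partialDeriv K (fun z => S.thetaMatrix e β b z K a) x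
      = -2 * S.metricCoeff e A β K x * logPartial K (S.pairing e β) x := by
    have : ∑ a, S.holoMatrix e A b x K a
        * partialDeriv K (fun z => S.thetaMatrix e β b z K a) x
        = -(A K (x K))⁻¹ * ∑ a, b.repr (S.curve e K.1 (x K)) (some a)
          * partialDeriv K (fun z => S.thetaMatrix e β b z K a) x := by
      rw [Finset.mul_sum]
      refine Finset.sum_congr rfl fun a _ => ?_
      rw [holoMatrix, of_apply]
      ring
    rw [this, h2]
    field_simp
  have h4 : ∑ a, partialDeriv K (fun z => S.holoMatrix e A b z K a) x * S.thetaMatrix e β b x K a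
      = partialDeriv K (S.metricCoeff e A β K) x
        + 2 * S.metricCoeff e A β K x * logPartial K (S.pairing e β) x := by
    have h5 := partialDeriv_congr hU.isOpen
      (f := fun z => ∑ a, S.holoMatrix e A b z K a * S.thetaMatrix e β b z K a)
      (g := S.metricCoeff e A β K) (fun z hz => by simp [hS.duality z hz K K]) hx K
    rw [partialDeriv_sum _ fun a _ => (dF a).fun_mul (dθ a)] at h5
    simp_rw [fun a => partialDeriv_mul (dF a) (dθ a) K] at h5
    rw [Finset.sum_add_distrib, h3] at h5
    linarith
  have h6 : frameTrace (S.metricCoeff e A β) (S.thetaMatrix e β b) (S.holoMatrix e A b) K x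
      = (S.metricCoeff e A β K x)⁻¹ * ∑ a, partialDeriv K (fun z => S.holoMatrix e A b z K a) x
        * S.thetaMatrix e β b x K a := by
    rw [frameTrace, mul_apply, Finset.mul_sum]
    refine Finset.sum_congr rfl fun a _ => ?_
    simp only [frameMatrix, of_apply, matrixDeriv, transpose_apply]
    ring
  rw [h6, h4]
  simp only [logPartial]
  field_simp

omit hb in
theorem logPartial_metricCoeff (hx : x ∈ U) (I K : Slot d) :
    logPartial K (S.metricCoeff e A β I) x = logPartial K (S.vandermonde I) x
      + logPartial K (S.pairingOff e I.1) x - logPartial K (fun z => A I (z I)) x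
      - logPartial K (S.pairing e β) x := by
  have dV := (S.contDiff_vandermonde I).contDiffOn.differentiableAt_of_mem hU.isOpen hx
  have dP := (S.contDiff_pairingOff e I.1).contDiffOn.differentiableAt_of_mem hU.isOpen hx
  have dw := (S.contDiff_pairing e β).contDiffOn.differentiableAt_of_mem hU.isOpen hx
  have dA := (hU.smooth_A I).differentiableAt_of_mem hU.isOpen hx
  have hV := hU.vandermonde_ne_zero hx I
  have hP := hU.pairingOff_ne_zero hx I
  have hA := hU.A_ne_zero x hx I
  have hw := hU.pairing_ne_zero x hx
  have hAw : A I (x I) * S.pairing e β x ≠ 0 := mul_ne_zero hA hw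
  rw [show S.metricCoeff e A β I = fun z => S.vandermonde I z * S.pairingOff e I.1 z
    * (A I (z I) * S.pairing e β z)⁻¹ from funext fun z => div_eq_mul_inv _ _,
    logPartial_mul (dV.fun_mul dP) ((dA.fun_mul dw).fun_inv hAw) (mul_ne_zero hV hP)
      (inv_ne_zero hAw), logPartial_mul dV dP hV hP,
    logPartial_inv (dA.fun_mul dw) hAw, logPartial_mul dA dw hA hw]
  ring

omit hU hb in
theorem _root_.SegreVeronese.pairingProd_eq (z : Slot d → ℝ) :
    S.pairingProd e z = ∏ I : Slot d, S.pairingOff e I.1 z := by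
  simp [pairingProd, Fintype.prod_sigma]

omit hb in
theorem pairingProd_ne_zero (hx : x ∈ U) : S.pairingProd e x ≠ 0 := by
  rw [pairingProd_eq]
  exact Finset.prod_ne_zero_iff.mpr fun I _ => hU.pairingOff_ne_zero hx I

/-- The logarithmic derivative of the determinant of the fibre metric. -/
theorem two_mul_trace_fibreConnection (hx : x ∈ U) (K : Slot d) :
    2 * (fibreConnection (S.metricCoeff e A β) (S.thetaMatrix e β b) (S.holoMatrix e A b) K
      x).trace
      = logPartial K (S.pairingProd e) x + logPartial K (fun z => A K (z K)) x
        - ((∑ j, d j : ℕ) + 2) * logPartial K (S.pairing e β) x := by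
  rw [(hU.isSeparableKahler hb).two_mul_trace_fibreConnection hx, hU.frameTrace_eq hb hx]
  change ∑ I, logPartial K (S.metricCoeff e A β I) x - _ = _
  simp_rw [hU.logPartial_metricCoeff hx]
  have h1 : ∑ I : Slot d, logPartial K (S.pairingOff e I.1) x = logPartial K (S.pairingProd e) x := by
    rw [show S.pairingProd e = _ from funext fun z => S.pairingProd_eq z,
      logPartial_prod _ (fun I _ => (S.contDiff_pairingOff e
        I.1).contDiffOn.differentiableAt_of_mem hU.isOpen hx)
        fun I _ => hU.pairingOff_ne_zero hx I]
  have h2 : ∑ I : Slot d, logPartial K (fun z => A I (z I)) x = logPartial K (fun z => A K (z K)) x :=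
    Finset.sum_eq_single K (fun I _ h => by
      rw [logPartial, partialDeriv_comp_apply_of_ne h, mul_zero]) (by simp)
  have h3 : logPartial K (S.pairingOff e K.1) x = 0 := by
    rw [logPartial, partialDeriv_eq_zero_of_forall (fun z t => S.pairingOff_add_single e z K t),
      mul_zero]
  -- The coefficient `m + 2` of `∂_K log ⟨μ, β⟩`: `m` from the coefficients `G_I`, one for each
  -- slot, and `2 (2 - 1)` from `2 q_K`.
  have hcard : Fintype.card (Slot d) = ∑ j, d j := by simp [Slot]
  simp only [Finset.sum_sub_distrib, Finset.sum_add_distrib, h1, h2, h3,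
    S.sum_logPartial_vandermonde (fun I => hU.vandermonde_ne_zero hx I), Finset.sum_const,
    Finset.card_univ, hcard, nsmul_eq_mul]
  ring

end IsAdmissible

end SegreVeronese

/-! ### The scalar curvature formula and the extremality criterion. -/

namespace SegreVeronese

open Matrix

variable {k : ℕ} {d : Fin k → ℕ} {W : Fin k → Type*} [∀ i, AddCommGroup (W i)]
  [∀ i, Module ℝ (W i)] (S : SegreVeronese d W) (e : ∀ i, Module.Basis (Fin 2) ℝ (W i))
  (A : Slot d → ℝ → ℝ) (β : S.space) (b : Module.Basis (Option (Slot d)) ℝ S.space)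

/-- The function `A_I ∏_p ⟨x̂_p, Γ_p⟩^{d_p} / ⟨μ, β⟩^{m+1}`. -/
def potentialTerm (I : Slot d) (x : Slot d → ℝ) : ℝ :=
  A I (x I) / S.pairing e β x ^ ((∑ j, d j) + 1) * S.pairingProd e x

/-- The sum of the second derivatives in the formula for the scalar curvature. -/
def curvatureSum (x : Slot d → ℝ) : ℝ :=
  ∑ I, S.pairing e β x ^ ((∑ j, d j) + 2) /
      (S.vandermonde I x * S.pairingOff e I.1 x * S.pairingProd e x) *
    partialDeriv I (partialDeriv I (S.potentialTerm e A β I)) x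

namespace IsAdmissible

variable {S e A β b} {U : Set (Slot d → ℝ)} (hU : S.IsAdmissible e A β U) (hb : b none = β)
  {x : Slot d → ℝ} (hx : x ∈ U)

include hU

theorem smooth_potentialTerm (I : Slot d) : ContDiffOn ℝ ∞ (S.potentialTerm e A β I) U :=
  ((hU.smooth_A I).div ((S.contDiff_pairing e β).pow _).contDiffOn
    fun z hz => pow_ne_zero _ (hU.pairing_ne_zero z hz)).mul (S.contDiff_pairingProd e).contDiffOn

theorem smooth_curvatureSum : ContDiffOn ℝ ∞ (S.curvatureSum e A β) U :=
  ContDiffOn.sum fun I _ => (((S.contDiff_pairing e β).pow _).contDiffOn.div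
    (((S.contDiff_vandermonde I).mul (S.contDiff_pairingOff e I.1)).mul
      (S.contDiff_pairingProd e)).contDiffOn fun _ hz => mul_ne_zero (mul_ne_zero
        (hU.vandermonde_ne_zero hz I) (hU.pairingOff_ne_zero hz I))
        (hU.pairingProd_ne_zero hz)).mul
    (((hU.smooth_potentialTerm I).partialDeriv hU.isOpen I).partialDeriv hU.isOpen I)

include hb

/-- The exponent here is `m + 1`, while the determinant of `H` produces `m + 2`; this accounts for
the extra `∂_K log ⟨μ, β⟩`. -/
theorem partialDeriv_potentialTerm (hx : x ∈ U) (K : Slot d) :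
    partialDeriv K (S.potentialTerm e A β K) x = S.potentialTerm e A β K x *
      (2 * (fibreConnection (S.metricCoeff e A β) (S.thetaMatrix e β b) (S.holoMatrix e A b) K
        x).trace + logPartial K (S.pairing e β) x) := by
  have dw := (S.contDiff_pairing e β).contDiffOn.differentiableAt_of_mem hU.isOpen hx
  have dP := (S.contDiff_pairingProd e).contDiffOn.differentiableAt_of_mem hU.isOpen hx
  have dA := (hU.smooth_A K).differentiableAt_of_mem hU.isOpen hx
  have hP := hU.pairingProd_ne_zero hx
  have hA := hU.A_ne_zero x hx K
  have hw := hU.pairing_ne_zero x hx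
  have hwn := pow_ne_zero ((∑ j, d j) + 1) hw
  have dwn : DifferentiableAt ℝ (fun z => S.pairing e β z ^ ((∑ j, d j) + 1)) x := dw.fun_pow _
  have hlog : logPartial K (S.potentialTerm e A β K) x
      = 2 * (fibreConnection (S.metricCoeff e A β) (S.thetaMatrix e β b) (S.holoMatrix e A b) K
        x).trace + logPartial K (S.pairing e β) x := by
    rw [hU.two_mul_trace_fibreConnection hb hx, show S.potentialTerm e A β K
      = fun z => A K (z K) * (S.pairing e β z ^ ((∑ j, d j) + 1))⁻¹ * S.pairingProd e z from
        funext fun z => by rw [potentialTerm, div_eq_mul_inv],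
      logPartial_mul (dA.fun_mul (dwn.fun_inv hwn)) dP (mul_ne_zero hA (inv_ne_zero hwn)) hP,
      logPartial_mul dA (dwn.fun_inv hwn) hA (inv_ne_zero hwn), logPartial_inv dwn hwn,
      logPartial_pow dw hw]
    push_cast
    ring
  have h0 : S.potentialTerm e A β K x ≠ 0 := mul_ne_zero (div_ne_zero hA hwn) hP
  rw [← hlog, logPartial, mul_inv_cancel_left₀ h0]

/-- With `l = ∂_K log ⟨μ, β⟩` one has `∂_K l = -l²`, so `∂_K (u + l) + (u + l)² = ∂_K u + u (u + 2
l)`. The exponent `m + 1` is what makes the `l²` terms cancel. -/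
theorem partialDeriv_partialDeriv_potentialTerm (hx : x ∈ U) (K : Slot d) :
    partialDeriv K (partialDeriv K (S.potentialTerm e A β K)) x = S.potentialTerm e A β K x *
      (partialDeriv K (fun z => 2 * (fibreConnection (S.metricCoeff e A β) (S.thetaMatrix e β b)
          (S.holoMatrix e A b) K z).trace) x
        + 2 * (fibreConnection (S.metricCoeff e A β) (S.thetaMatrix e β b) (S.holoMatrix e A b) K
            x).trace * (2 * (fibreConnection (S.metricCoeff e A β) (S.thetaMatrix e β b)
              (S.holoMatrix e A b) K x).trace + 2 * logPartial K (S.pairing e β) x)) := by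
  have hS := hU.isSeparableKahler hb
  have dw := (S.contDiff_pairing e β).contDiffOn.differentiableAt_of_mem hU.isOpen hx
  have dw' := ((S.contDiff_pairing e β).contDiffOn.partialDeriv hU.isOpen
    K).differentiableAt_of_mem hU.isOpen hx
  have hw := hU.pairing_ne_zero x hx
  have dwi : DifferentiableAt ℝ (fun z => (S.pairing e β z)⁻¹) x := dw.fun_inv hw
  have dp := (hU.smooth_potentialTerm K).differentiableAt_of_mem hU.isOpen hx
  have du : DifferentiableAt ℝ (fun z => 2 * (fibreConnection (S.metricCoeff e A β)
      (S.thetaMatrix e β b) (S.holoMatrix e A b) K z).trace) x :=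
    ((hS.smooth_fibreConnection K).trace.differentiableAt_of_mem hU.isOpen hx).const_mul 2
  have dl : DifferentiableAt ℝ (logPartial K (S.pairing e β)) x := dwi.fun_mul dw'
  have hl : partialDeriv K (logPartial K (S.pairing e β)) x
      = -logPartial K (S.pairing e β) x ^ 2 := by
    rw [show logPartial K (S.pairing e β) = fun z => (S.pairing e β z)⁻¹
      * partialDeriv K (S.pairing e β) z from rfl, partialDeriv_mul dwi dw',
      partialDeriv_inv dw hw, partialDeriv_partialDeriv_pairing]
    field_simp
    ring
  rw [partialDeriv_congr hU.isOpen (fun z hz => hU.partialDeriv_potentialTerm hb hz K) hx,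
    partialDeriv_mul dp (du.fun_add dl), partialDeriv_add du dl, hl,
    hU.partialDeriv_potentialTerm hb hx]
  ring

theorem scalarCurvature_metric {y : Slot d ⊕ Slot d → ℝ} (hy : baseCoord y ∈ U) :
    scalarCurvature (S.metric e A β b) y = -S.curvatureSum e A β (baseCoord y) := by
  rw [metric_eq_separableMetric, (hU.isSeparableKahler hb).scalarCurvature_eq hy, curvatureSum]
  congr 1
  refine Finset.sum_congr rfl fun K _ => ?_
  have hw := hU.pairing_ne_zero _ hy
  have hA := hU.A_ne_zero _ hy K
  have hV := hU.vandermonde_ne_zero hy K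
  have hΓ := hU.pairingOff_ne_zero hy K
  have hP := hU.pairingProd_ne_zero hy
  rw [hU.partialDeriv_partialDeriv_potentialTerm hb hy, hU.frameTrace_eq hb hy]
  change _ * (_ + _ * (_ + _ - logPartial K (S.metricCoeff e A β K) (baseCoord y))) = _
  have hcoef : S.pairing e β (baseCoord y) ^ ((∑ j, d j) + 2) /
      (S.vandermonde K (baseCoord y) * S.pairingOff e K.1 (baseCoord y)
        * S.pairingProd e (baseCoord y)) * S.potentialTerm e A β K (baseCoord y)
      = (S.metricCoeff e A β K (baseCoord y))⁻¹ := by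
    rw [potentialTerm, metricCoeff, pow_succ _ ((∑ j, d j) + 1)]
    field_simp
  rw [← mul_assoc, hcoef]
  ring

theorem isExtremalOn_iff {Ω : Set (Slot d ⊕ Slot d → ℝ)} (hΩ : baseCoord '' Ω = U)
    (hUc : IsPreconnected U) :
    IsExtremalOn (S.metric e A β b) (S.complexStructure e A β b) Ω ↔
      ∃ α : S.space, ∀ x ∈ U, S.pairing e β x * S.curvatureSum e A β x = S.pairing e α x := by
  have hφ : ContDiffOn ℝ ∞ (fun x => -S.curvatureSum e A β x) U := hU.smooth_curvatureSum.neg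
  have hiff := (hU.isSeparableKahler hb).isKillingPotentialOn_iff hφ
    (fun z hz => hU.scalarCurvature_metric hb hz) hΩ hUc
  rw [IsExtremalOn, metric_eq_separableMetric, complexStructure_eq_separable]
  rw [metric_eq_separableMetric] at hiff
  rw [hiff]
  constructor
  · rintro ⟨c, hc⟩
    -- The constants `c` are lifted from `𝔱` to `𝔥` with zero `β`-component; the integration
    -- constant `c₀` then supplies the multiple of `β`.
    let h : S.space := ∑ a, c a • b (some a)
    have hrepr : ∀ a, b.repr h (some a) = c a := fun a => by
      simp [h, Finsupp.single_apply]
    have hm := hU.smooth_momentum h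
    obtain ⟨c₀, hc₀⟩ := eqOn_const_of_partialDeriv_eq_zero
      (f := fun x => -S.curvatureSum e A β x - S.momentum e β h x) (hφ.sub hm) hU.isOpen hUc
      fun x hx J => by
        rw [partialDeriv_sub (hφ.differentiableAt_of_mem hU.isOpen hx)
          (hm.differentiableAt_of_mem hU.isOpen hx), hc x hx,
          hU.partialDeriv_momentum hb h hx]
        simp [hrepr]
    refine ⟨-(h + c₀ • β), fun x hx => ?_⟩
    have h1 := hc₀ x hx
    have hw := hU.pairing_ne_zero x hx
    have h3 : S.pairing e (-(h + c₀ • β)) x = -(S.pairing e h x + c₀ * S.pairing e β x) :=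
      map_neg (S.pairingₗ e x) (h + c₀ • β)
    have h2 : S.pairing e h x = S.pairing e β x * S.momentum e β h x := by
      rw [momentum]
      field_simp
    rw [h3, h2, ← h1]
    ring
  · rintro ⟨α, hα⟩
    -- Here `Scal = ⟨μ_β, -α⟩`; the dropped coordinate at `none` only shifts it by a constant.
    refine ⟨fun a => b.repr (-α) (some a), fun x hx J => ?_⟩
    rw [← hU.partialDeriv_momentum hb _ hx]
    refine partialDeriv_congr hU.isOpen (fun z hz => ?_) hx J
    have hw := hU.pairing_ne_zero z hz
    have h1 : S.pairing e (-α) z = -S.pairing e α z := map_neg (S.pairingₗ e z) α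
    rw [momentum, h1, ← hα z hz]
    field_simp

end IsAdmissible

end SegreVeronese

end

/-! ### The theorem on `Ω`. -/

theorem mainTheorem4 {k : ℕ} {d : Fin k → ℕ} {W : Fin k → Type*}
    [∀ i, AddCommGroup (W i)] [∀ i, Module ℝ (W i)]
    (S : SegreVeronese d W)
    (e : ∀ i, Module.Basis (Fin 2) ℝ (W i))
    (β : S.space) (b : Module.Basis (Option (Slot d)) ℝ S.space) (hb : b none = β)
    (A : Slot d → ℝ → ℝ)
    (Ω : Set (Slot d ⊕ Slot d → ℝ)) (hΩ : IsOpen Ω) (hΩc : IsConnected Ω)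
    (hA : ∀ I, ContDiffOn ℝ ∞ (A I) ((fun y => y (Sum.inl I)) '' Ω))
    (hA0 : ∀ y ∈ Ω, ∀ I, A I (y (Sum.inl I)) ≠ 0)
    (hβ : ∀ y ∈ Ω, S.pairing e β (SegreVeronese.xCoord y) ≠ 0)
    (hpos : ∀ y ∈ Ω, ∀ I, 0 < S.metricCoeff e A β I (SegreVeronese.xCoord y)) :
    (∀ y ∈ Ω, scalarCurvature (S.metric e A β b) y =
      -∑ I, S.pairing e β (SegreVeronese.xCoord y) ^ ((∑ j, d j) + 2) /
          (S.vandermonde I (SegreVeronese.xCoord y) *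
            S.pairingOff e I.1 (SegreVeronese.xCoord y) *
            S.pairingProd e (SegreVeronese.xCoord y)) *
        partialDeriv I (partialDeriv I fun x =>
            A I (x I) / S.pairing e β x ^ ((∑ j, d j) + 1) * S.pairingProd e x)
          (SegreVeronese.xCoord y)) ∧
    (IsExtremalOn (S.metric e A β b) (S.complexStructure e A β b) Ω ↔
      ∃ α : S.space, ∀ y ∈ Ω,
        ∑ I, S.pairing e β (SegreVeronese.xCoord y) ^ ((∑ j, d j) + 3) /
            (S.vandermonde I (SegreVeronese.xCoord y) *
              S.pairingOff e I.1 (SegreVeronese.xCoord y) *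
              S.pairingProd e (SegreVeronese.xCoord y)) *
          partialDeriv I (partialDeriv I fun x =>
              A I (x I) / S.pairing e β x ^ ((∑ j, d j) + 1) * S.pairingProd e x)
            (SegreVeronese.xCoord y)
        = S.pairing e α (SegreVeronese.xCoord y)) := by
  -- All data are torus-invariant, so the work takes place on the projection of `Ω`, which is open
  -- and connected.
  have hU : S.IsAdmissible e A β (baseCoord '' Ω) :=
    { isOpen := isOpenMap_baseCoord Ω hΩ
      smooth_A := fun I => (hA I).comp (contDiff_apply ℝ ℝ I).contDiffOn (by
        rintro _ ⟨y, hy, rfl⟩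
        exact ⟨y, hy, rfl⟩)
      A_ne_zero := by
        rintro _ ⟨y, hy, rfl⟩ I
        exact hA0 y hy I
      pairing_ne_zero := by
        rintro _ ⟨y, hy, rfl⟩
        exact hβ y hy
      metricCoeff_ne_zero := by
        rintro _ ⟨y, hy, rfl⟩ I
        exact (hpos y hy I).ne' }
  refine ⟨fun y hy => hU.scalarCurvature_metric hb (Set.mem_image_of_mem _ hy), ?_⟩
  rw [hU.isExtremalOn_iff hb rfl (hΩc.image _ continuous_baseCoord.continuousOn).isPreconnected]
  refine exists_congr fun α => ?_
  rw [Set.forall_mem_image]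
  refine forall₂_congr fun y _ => ?_
  rw [SegreVeronese.curvatureSum, Finset.mul_sum]
  refine Eq.congr (Finset.sum_congr rfl fun I _ => ?_) rfl
  -- The exponent `m + 3` is `m + 2` plus the factor `⟨μ, β⟩` that turns a momentum into a pairing.
  rw [pow_succ _ ((∑ j, d j) + 2)]
  exact (show ∀ w p c D : ℝ, w * (p / c * D) = p * w / c * D from fun _ _ _ _ => by ring) _ _ _ _
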